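/- Let $\mathbb{F}_q$ be a finite field with $q$ elements, $A=\mathbb{F}_q[\theta]$, and let $\phi\colon A\to A\{\tau\}$ be a Drinfeld $A$-module of rank $r$, i.e. an $\mathbb{F}_q$-algebra homomorphism with $\phi_\theta=\theta+\phi_{\theta,1}\tau+\dots+\phi_{\theta,r}\tau^r$, $\phi_{\theta,r}\neq 0$, where $\tau a=a^q\tau$ for $a\in A$. Let $n\ge 0$, $\mathbb{A}=\mathbb{F}_q(z_1,\dots,z_n)[\theta]$, let $\tau$ act on $\mathbb{A}$ as the $\mathbb{F}_q(z_1,\dots,z_n)$-algebra endomorphism with $\tau(\theta)=\theta^q$, put $\ell_i(z)=\prod_{j=0}^{i-1}(z-\theta^{q^j})$, and let $\varphi\colon\mathbb{A}\to\mathbb{A}\{\tau\}$ be the $\mathbb{F}_q(z_1,\dots,z_n)$-algebra homomorphism with $$\varphi_\theta=\sum_{i=0}^r \ell_i(z_1)\cdots\ell_i(z_n)\,\phi_{\theta,i}\,\tau^i\qquad(\phi_{\theta,0}=\theta).$$ Let $f\in A$ be monic and irreducible of degree $d$, let $r_0$ be the largest $i$ with $f\nmid\phi_{\theta,i}$, and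 assume that such an $i$ exists and $r_0\ge 1$. Let $\overline{\phi}$ be the reduction of $\phi$ modulo $f$. For a monic irreducible $h\in A$ with $h\ne f$ let $T_h(\overline{\phi})=\varprojlim_m \overline{\phi}[h^m]$ be its $h$-adic Tate module, where $\overline{\phi}[h^m]$ is the $h^m$-torsion of $\overline{\phi}$ in an algebraic closure of $A/fA$; it is free of rank $r_0$ over the $h$-adic completion $A_h$ of $A$. Let $$P_\phi(x)=x^{r_0}+p_{r_0-1}x^{r_0-1}+\dots+p_1x+p_0$$ be the characteristic polynomial of the action of $\tau^d$ on $T_h(\overline{\phi})$; it has coefficients in $A$, does not depend on $h$, and $p_0=c(f)^{-1}f$ for some $c(f)\in\mathbb{F}_q^\times$. Let $\varphi(\mathbb{A}/f\mathbb{A})$ be $\mathbb{A}/f\mathbb{A}$ with the $\mathbb{A}$-module structure induced by $\varphi$. For an $\mathbb{A}$-module $M\cong\bigoplus_{i=1}^m\mathbb{A}/f_i\mathbb{A}$ with all $f_i$ monic, let $[M]_{\mathbb{A}}=f_1\cdots f_m$ be the monic generator of its Fitting ideal. Then $[\varphi(\mathbb{A}/f\mathbb{A})]_{\mathbb{A}}$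 exists, is uniquely determined, and $$\big[\varphi(\mathbb{A}/f\mathbb{A})\big]_{\mathbb{A}}=f+\sum_{i=1}^{r_0-1}c(f)\,p_i\prod_{k=1}^n f(z_k)^i+c(f)\prod_{k=1}^n f(z_k)^{r_0}.$$ -/

import Mathlib

open Polynomial

noncomputable section

/-! ### Twisted polynomials -/

/-- The ring `K[θ]{τ}` of twisted polynomials `∑ aᵢ τⁱ` over `K[θ]`, with `τ · a = τ(a) · τ`, where
`τ` is the `K`-algebra endomorphism of `K[θ]` with `τ(θ) = θ ^ q` (that is, `Polynomial.expand`).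
The variable `θ` is `Polynomial.X`. -/
@[nolint unusedArguments]
def TwistedPoly (_q : ℕ) (K : Type*) [Field K] : Type _ := SkewPolynomial K[X]

namespace TwistedPoly

/-- The action of the powers of `τ` on `K[θ]`. -/
@[reducible] def tauAction (q : ℕ) (K : Type*) [Field K] :
    MulSemiringAction (Multiplicative ℕ) K[X] where
  smul m a := (expand K q)^[m.toAdd] a
  one_smul _ := rfl
  mul_smul m m' a := Function.iterate_add_apply _ m.toAdd m'.toAdd a
  smul_zero m := iterate_map_zero (expand K q) m.toAdd
  smul_add m := iterate_map_add (expand K q) m.toAdd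
  smul_one m := iterate_map_one (expand K q) m.toAdd
  smul_mul m := iterate_map_mul (expand K q) m.toAdd

theorem tauAction_comm (q : ℕ) (K : Type*) [Field K] :
    @SMulCommClass (Multiplicative ℕ) K K[X] (tauAction q K).toSMul _ :=
  @SMulCommClass.mk _ _ _ (tauAction q K).toSMul _ fun m c a => by
    change (expand K q)^[m.toAdd] (c • a) = c • (expand K q)^[m.toAdd] a
    generalize m.toAdd = k
    induction k generalizing a with
    | zero => rfl
    | succ k ih => rw [Function.iterate_succ_apply, map_smul, ih, Function.iterate_succ_apply]

instance (q : ℕ) (K : Type*) [Field K] : Ring (TwistedPoly q K) :=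
  @SkewMonoidAlgebra.instRing K[X] (Multiplicative ℕ) _ _ (tauAction q K)

instance (q : ℕ) (K : Type*) [Field K] : Algebra K (TwistedPoly q K) :=
  @SkewMonoidAlgebra.instAlgebraOfSMulCommClass K (Multiplicative ℕ) _ _ K[X] _ _ (tauAction q K)
    (tauAction_comm q K)

/-- The coefficient of `τ ^ i`. -/
def coeff {q : ℕ} {K : Type*} [Field K] (P : TwistedPoly q K) (i : ℕ) : K[X] :=
  SkewPolynomial.coeff P i

/-- The set of exponents `i` for which the coefficient of `τ ^ i` is non-zero. -/
def support {q : ℕ} {K : Type*} [Field K] (P : TwistedPoly q K) : Finset ℕ :=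
  SkewPolynomial.support P

/-- The twisted polynomial `a τ ^ i`. -/
def monomial (q : ℕ) {K : Type*} [Field K] (i : ℕ) (a : K[X]) : TwistedPoly q K :=
  SkewPolynomial.monomial i a

end TwistedPoly

/-- Let `B` be a `K`-algebra with a `K`-algebra homomorphism `ι : K[θ] → B` and a `K`-algebra
endomorphism `σ` (playing the role of `τ` on `B`). A twisted polynomial `∑ aᵢ τⁱ` acts on `B` by
`b ↦ ∑ ι(aᵢ) σⁱ(b)`. -/
def TwistedPoly.act {q : ℕ} {K B : Type*} [Field K] [CommRing B] [Algebra K B]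
    (ι : K[X] →ₐ[K] B) (σ : B →ₐ[K] B) (P : TwistedPoly q K) : B →ₗ[K] B :=
  ∑ i ∈ P.support, LinearMap.mulLeft K (ι (P.coeff i)) ∘ₗ (σ ^ i).toLinearMap

/-! ### Drinfeld modules -/

/-- A Drinfeld `A`-module of rank `r` over `A = 𝔽_q[θ]`: an `𝔽_q`-algebra homomorphism
`φ : A → A{τ}` with `φ_θ = θ + φ_{θ,1} τ + ⋯ + φ_{θ,r} τ ^ r` and `φ_{θ,r} ≠ 0`. -/
structure DrinfeldModule (Fq : Type*) [Field Fq] [Fintype Fq] (r : ℕ) where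
  /-- The homomorphism `φ : A → A{τ}`. -/
  toAlgHom : Fq[X] →ₐ[Fq] TwistedPoly (Fintype.card Fq) Fq
  coeff_zero : (toAlgHom X).coeff 0 = X
  coeff_rank : (toAlgHom X).coeff r ≠ 0
  coeff_eq_zero : ∀ i, r < i → (toAlgHom X).coeff i = 0

/-- The coefficient `φ_{θ,i}` of `τ ^ i` in `φ_θ`. -/
def DrinfeldModule.coeff {Fq : Type*} [Field Fq] [Fintype Fq] {r : ℕ} (φ : DrinfeldModule Fq r)
    (i : ℕ) : Fq[X] :=
  (φ.toAlgHom X).coeff i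

/-- The field `𝔽_q(z₁, …, z_n)`. -/
abbrev RatFunField (Fq : Type*) [Field Fq] (n : ℕ) : Type _ :=
  FractionRing (MvPolynomial (Fin n) Fq)

/-- The indeterminate `z_k` in `𝔽_q(z₁, …, z_n)`. -/
def zVar (Fq : Type*) [Field Fq] {n : ℕ} (k : Fin n) : RatFunField Fq n :=
  algebraMap (MvPolynomial (Fin n) Fq) (RatFunField Fq n) (MvPolynomial.X k)

/-- `ℓ_i(z) = ∏_{j < i} (z - θ ^ (q ^ j))` in `K[θ]`, for `z` in `K`. -/
def ell (q : ℕ) {K : Type*} [Field K] (i : ℕ) (z : K) : K[X] :=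
  ∏ j ∈ Finset.range i, (C z - X ^ q ^ j)

/-- The Drinfeld `𝔸`-module `φ : 𝔸 → 𝔸{τ}` over `𝔸 = 𝔽_q(z₁, …, z_n)[θ]` attached to `φ`: the
`𝔽_q(z₁, …, z_n)`-algebra homomorphism sending `θ` to
`∑_{i ≤ r} ℓ_i(z₁) ⋯ ℓ_i(z_n) φ_{θ,i} τ ^ i`. -/
def DrinfeldModule.deformation {Fq : Type*} [Field Fq] [Fintype Fq] {r : ℕ}
    (φ : DrinfeldModule Fq r) (n : ℕ) :
    (RatFunField Fq n)[X] →ₐ[RatFunField Fq n]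
      TwistedPoly (Fintype.card Fq) (RatFunField Fq n) :=
  aeval (∑ i ∈ Finset.range (r + 1), TwistedPoly.monomial (Fintype.card Fq) i
    ((∏ k : Fin n, ell (Fintype.card Fq) i (zVar Fq k)) *
      (φ.coeff i).map (algebraMap Fq (RatFunField Fq n))))

/-! ### The module obtained by reducing the deformation modulo `f` -/

theorem aeval_root_pow_card {Fq K : Type*} [Field Fq] [Fintype Fq] [Field K] [Algebra Fq K]
    (f : Fq[X]) :
    (f.map (algebraMap Fq K)).eval₂
      (Algebra.ofId K (AdjoinRoot (f.map (algebraMap Fq K))))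
      (AdjoinRoot.root (f.map (algebraMap Fq K)) ^ Fintype.card Fq) = 0 := by
  set g := f.map (algebraMap Fq K) with hg
  have h1 : expand K (Fintype.card Fq) g = g ^ Fintype.card Fq := by
    rw [hg, ← map_expand, FiniteField.expand_card, Polynomial.map_pow]
  have h2 : aeval (AdjoinRoot.root g ^ Fintype.card Fq) g = 0 := by
    rw [← expand_aeval, h1, map_pow, AdjoinRoot.aeval_eq, AdjoinRoot.mk_self,
      zero_pow Fintype.card_ne_zero]
  exact h2

/-- The endomorphism of `K[θ] / f K[θ]` induced by `τ`, where `f` has coefficients in `𝔽_q`: it is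
`K`-linear, multiplicative, and sends `θ` to `θ ^ q`. -/
def tauQuot {Fq : Type*} (K : Type*) [Field Fq] [Fintype Fq] [Field K] [Algebra Fq K]
    (f : Fq[X]) :
    AdjoinRoot (f.map (algebraMap Fq K)) →ₐ[K] AdjoinRoot (f.map (algebraMap Fq K)) :=
  AdjoinRoot.liftAlgHom (f.map (algebraMap Fq K)) (Algebra.ofId K _)
    (AdjoinRoot.root (f.map (algebraMap Fq K)) ^ Fintype.card Fq) (aeval_root_pow_card f)

/-- For a `K`-algebra homomorphism `ψ : K[θ] → K[θ]{τ}` and `f ∈ 𝔽_q[θ]`, the `K[θ]`-module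
`ψ(K[θ] / f K[θ])`: the `K`-vector space `K[θ] / f K[θ]` on which `θ` acts through `ψ_θ`
(and hence `a ∈ K[θ]` acts through `ψ_a`). -/
abbrev QuotModule {Fq K : Type*} [Field Fq] [Fintype Fq] [Field K] [Algebra Fq K]
    (ψ : K[X] →ₐ[K] TwistedPoly (Fintype.card Fq) K) (f : Fq[X]) : Type _ :=
  Module.AEval' ((ψ X).act (AdjoinRoot.mkₐ (f.map (algebraMap Fq K))) (tauQuot K f))

/-- `g` is the monic generator `[M]_{k[θ]}` of the Fitting ideal of the `k[θ]`-module `M`: there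
are monic polynomials `f₁, …, f_m` with `M ≅ ⨁ k[θ] / f_i k[θ]` and `g = f₁ ⋯ f_m`. -/
def IsFittingGenerator {k : Type*} [Field k] (M : Type*) [AddCommGroup M] [Module k[X] M]
    (g : k[X]) : Prop :=
  ∃ (m : ℕ) (F : Fin m → k[X]), (∀ i, (F i).Monic) ∧
    Nonempty (M ≃ₗ[k[X]] DirectSum (Fin m) fun i => k[X] ⧸ Ideal.span {F i}) ∧
    g = ∏ i, F i

/-! ### Tate modules -/

/-- The Tate module `T_h(M) = lim M[h ^ n]` of an `R`-module `M`, the transition maps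
`M[h ^ (n + 1)] → M[h ^ n]` being multiplication by `h`. -/
def tateSubmodule {R : Type*} [CommRing R] (h : R) (M : Type*) [AddCommGroup M] [Module R M] :
    Submodule R (ℕ → M) where
  carrier := {x | (∀ n, h ^ n • x n = 0) ∧ ∀ n, h • x (n + 1) = x n}
  zero_mem' := by simp
  add_mem' := by
    rintro x y ⟨hx, hx'⟩ ⟨hy, hy'⟩
    exact ⟨fun n => by simp [hx, hy], fun n => by simp [hx', hy']⟩
  smul_mem' := by
    rintro c x ⟨hx, hx'⟩
    exact ⟨fun n => by simp [smul_comm _ c, hx], fun n => by simp [smul_comm _ c, hx']⟩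

/-- The Tate module `T_h(M)`, as a type. -/
abbrev TateModule {R : Type*} [CommRing R] (h : R) (M : Type*) [AddCommGroup M] [Module R M] :
    Type _ :=
  tateSubmodule h M

/-- The `h`-adic completion `R_h = lim R / h ^ n R`. -/
abbrev HCompletion {R : Type*} [CommRing R] (h : R) : Type _ :=
  AdicCompletion (Ideal.span {h}) R

namespace TateModule

variable {R : Type*} [CommRing R] {h : R} {M : Type*} [AddCommGroup M] [Module R M]

/-- A representative in `R` of the class modulo `h ^ n` of `a ∈ R_h`. -/
def rep (a : HCompletion h) (n : ℕ) : R :=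
  Quotient.out (AdicCompletion.evalₐ (Ideal.span {h}) n a)

theorem mk_rep (a : HCompletion h) (n : ℕ) :
    Ideal.Quotient.mk (Ideal.span {h} ^ n) (rep a n)
      = AdicCompletion.evalₐ (Ideal.span {h}) n a :=
  Quotient.out_eq _

theorem smul_eq_of_mk_eq (x : TateModule h M) (n : ℕ) {b c : R}
    (hbc : Ideal.Quotient.mk (Ideal.span {h} ^ n) b = Ideal.Quotient.mk (Ideal.span {h} ^ n) c) :
    b • x.1 n = c • x.1 n := by
  rw [Ideal.Quotient.mk_eq_mk_iff_sub_mem, Ideal.span_singleton_pow,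
    Ideal.mem_span_singleton'] at hbc
  obtain ⟨e, he⟩ := hbc
  rw [← sub_eq_zero, ← sub_smul, ← he, mul_smul, x.2.1 n, smul_zero]

theorem rep_smul_eq (x : TateModule h M) (a : HCompletion h) (n : ℕ) {b : R}
    (hb : Ideal.Quotient.mk (Ideal.span {h} ^ n) b
      = AdicCompletion.evalₐ (Ideal.span {h}) n a) :
    rep a n • x.1 n = b • x.1 n :=
  smul_eq_of_mk_eq x n ((mk_rep a n).trans hb.symm)

/-- `a = (aₙ mod hⁿ)ₙ` in `R_h` acts on `x = (xₙ)ₙ` in `T_h(M)` by `a • x = (aₙ • xₙ)ₙ`. -/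
instance : SMul (HCompletion h) (TateModule h M) where
  smul a x := ⟨fun n => rep a n • x.1 n, by
    refine ⟨fun n => by rw [smul_comm, x.2.1 n, smul_zero], fun n => ?_⟩
    obtain ⟨s, rfl⟩ := AdicCompletion.mk_surjective (Ideal.span {h}) R a
    have key : ∀ m, rep (AdicCompletion.mk (Ideal.span {h}) R s) m • x.1 m = s m • x.1 m :=
      fun m => rep_smul_eq x _ m (AdicCompletion.evalₐ_mk _ m s).symm
    have hs : Ideal.Quotient.mk (Ideal.span {h} ^ n) (s (n + 1))
        = Ideal.Quotient.mk (Ideal.span {h} ^ n) (s n) := by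
      have := s.2 (Nat.le_succ n)
      rw [SModEq.comm, SModEq.sub_mem] at this
      rw [Ideal.Quotient.mk_eq_mk_iff_sub_mem]
      simpa using this
    dsimp only
    rw [key, key, smul_comm, x.2.2 n, smul_eq_of_mk_eq x n hs]⟩

theorem completion_smul_val (a : HCompletion h) (x : TateModule h M) (n : ℕ) :
    (a • x).1 n = rep a n • x.1 n := rfl

instance : Module (HCompletion h) (TateModule h M) where
  one_smul x := by
    ext n
    rw [completion_smul_val, rep_smul_eq (b := 1) x _ n (by simp), one_smul]
  mul_smul a b x := by
    ext n
    rw [completion_smul_val, rep_smul_eq (b := rep a n * rep b n) x _ n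
      (by rw [map_mul, map_mul, mk_rep, mk_rep]), mul_smul]
    rfl
  smul_zero a := by
    ext n
    exact smul_zero _
  smul_add a x y := by
    ext n
    exact smul_add _ _ _
  add_smul a b x := by
    ext n
    rw [completion_smul_val, rep_smul_eq (b := rep a n + rep b n) x _ n
      (by rw [map_add, map_add, mk_rep, mk_rep]), add_smul]
    rfl
  zero_smul x := by
    ext n
    rw [completion_smul_val, rep_smul_eq (b := 0) x _ n (by simp), zero_smul]
    rfl

/-- The endomorphism of `T_h(M)` induced by an endomorphism of `M`. -/
def map (u : M →ₗ[R] M) : TateModule h M →ₗ[HCompletion h] TateModule h M where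
  toFun x := ⟨fun n => u (x.1 n), fun n => by rw [← map_smul, x.2.1 n, map_zero],
    fun n => by rw [← map_smul, x.2.2 n]⟩
  map_add' x y := by
    ext n
    exact map_add u _ _
  map_smul' a x := by
    ext n
    exact map_smul u _ _

end TateModule

/-! ### The reduction of a Drinfeld module at `f` and its Frobenius -/

section Reduction

variable {Fq : Type*} [Field Fq] [Fintype Fq] {r : ℕ}

/-- An algebraic closure of the residue field `A / fA`. -/
abbrev ResidueClosure (f : Fq[X]) [Fact (Irreducible f)] : Type _ :=
  AlgebraicClosure (AdjoinRoot f)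

/-- The reduction map from `A` to the algebraic closure of `A / fA`. -/
def toResidueClosure (f : Fq[X]) [Fact (Irreducible f)] : Fq[X] →ₐ[Fq] ResidueClosure f :=
  (IsScalarTower.toAlgHom Fq (AdjoinRoot f) (ResidueClosure f)).comp (AdjoinRoot.mkₐ f)

/-- The action of `θ` through the reduction `∑ (φ_{θ,i} mod f) τ ^ i` of `φ_θ` on the algebraic
closure of `A / fA`, where `τ` is `x ↦ x ^ q`. -/
def DrinfeldModule.reductionAct (φ : DrinfeldModule Fq r) (f : Fq[X]) [Fact (Irreducible f)] :
    ResidueClosure f →ₗ[Fq] ResidueClosure f :=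
  (φ.toAlgHom X).act (toResidueClosure f) (FiniteField.frobeniusAlgHom Fq (ResidueClosure f))

/-- The algebraic closure of `A / fA` as an `A`-module through the reduction of `φ` modulo `f`. -/
abbrev DrinfeldModule.ReductionPoints (φ : DrinfeldModule Fq r) (f : Fq[X])
    [Fact (Irreducible f)] : Type _ :=
  Module.AEval' (φ.reductionAct f)

theorem frobenius_pow_toResidueClosure (f : Fq[X]) [Fact (Irreducible f)] (a : Fq[X]) :
    (FiniteField.frobeniusAlgHom Fq (ResidueClosure f) ^ f.natDegree) (toResidueClosure f a)
      = toResidueClosure f a := by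
  have hf : f ≠ 0 := (Fact.out : Irreducible f).ne_zero
  have : Module.Finite Fq (AdjoinRoot f) := (AdjoinRoot.powerBasis hf).finite
  have : Finite (AdjoinRoot f) := Module.finite_of_finite Fq
  have : Fintype (AdjoinRoot f) := Fintype.ofFinite _
  have hcard : Fintype.card (AdjoinRoot f) = Fintype.card Fq ^ f.natDegree := by
    rw [Module.card_eq_pow_finrank (K := Fq), (AdjoinRoot.powerBasis hf).finrank,
      AdjoinRoot.powerBasis_dim]
  have hb : ∀ b : AdjoinRoot f, b ^ Fintype.card Fq ^ f.natDegree = b := fun b => by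
    rw [← hcard, FiniteField.pow_card]
  rw [AlgHom.coe_pow, FiniteField.coe_frobeniusAlgHom, pow_iterate]
  change (algebraMap _ _ (AdjoinRoot.mk f a)) ^ _ = algebraMap _ _ (AdjoinRoot.mk f a)
  rw [← map_pow, hb]

theorem DrinfeldModule.frobenius_comm (φ : DrinfeldModule Fq r) (f : Fq[X])
    [Fact (Irreducible f)] (x : ResidueClosure f) :
    (FiniteField.frobeniusAlgHom Fq (ResidueClosure f) ^ f.natDegree) (φ.reductionAct f x)
      = φ.reductionAct f
        ((FiniteField.frobeniusAlgHom Fq (ResidueClosure f) ^ f.natDegree) x) := by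
  simp only [reductionAct, TwistedPoly.act, LinearMap.sum_apply, LinearMap.comp_apply,
    LinearMap.mulLeft_apply, AlgHom.toLinearMap_apply, map_sum, map_mul,
    frobenius_pow_toResidueClosure]
  refine Finset.sum_congr rfl fun i _ => ?_
  rw [← AlgHom.mul_apply, ← AlgHom.mul_apply, ← pow_add, ← pow_add, add_comm]

/-- The Frobenius `τ ^ d : x ↦ x ^ (q ^ d)`, with `d = deg f`, as an endomorphism of the
`A`-module given by the reduction of `φ` modulo `f`. -/
def DrinfeldModule.frobenius (φ : DrinfeldModule Fq r) (f : Fq[X]) [Fact (Irreducible f)] :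
    φ.ReductionPoints f →ₗ[Fq[X]] φ.ReductionPoints f :=
  LinearMap.ofAEval (φ.reductionAct f)
    ((Module.AEval'.of (φ.reductionAct f)).toLinearMap ∘ₗ
      (FiniteField.frobeniusAlgHom Fq (ResidueClosure f) ^ f.natDegree).toLinearMap)
    (fun x => (congrArg (Module.AEval'.of (φ.reductionAct f)) (φ.frobenius_comm f x)).trans
      (Module.AEval'.X_smul_of (φ.reductionAct f) _).symm)

/-- `s = r₀` is the degree in `τ` of the reduction of `φ_θ` modulo `f`. -/
def DrinfeldModule.IsReductionDegree (φ : DrinfeldModule Fq r) (f : Fq[X]) (s : ℕ) : Prop :=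
  ¬ f ∣ φ.coeff s ∧ ∀ i, s < i → f ∣ φ.coeff i

/-- `P ∈ A[x]` is the characteristic polynomial of the action of `τ ^ d` on the Tate module
`T_h` of the reduction of `φ` modulo `f`, this Tate module being free of rank `s` over `A_h`. -/
def DrinfeldModule.IsFrobeniusCharpoly (φ : DrinfeldModule Fq r) (f : Fq[X])
    [Fact (Irreducible f)] (s : ℕ) (h : Fq[X]) (P : Fq[X][X]) : Prop :=
  ∃ b : Module.Basis (Fin s) (HCompletion h) (TateModule h (φ.ReductionPoints f)),
    P.map (algebraMap Fq[X] (HCompletion h))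
      = (LinearMap.toMatrix b b (TateModule.map (φ.frobenius f))).charpoly

end Reduction

end

open Polynomial

noncomputable section

/-! Let κ be an algebraic closure of A/f, d = deg f, s = r₀, and let t act on κ{τ} by right
multiplication with the reduced φ_θ; right multiplication by τ^d commutes with it. Over κ[t] the
module has basis 1, …, τ^(s-1), and τ^d has a matrix `frobMatrix`. Over κ[x] with x = τ^d it has
basis 1, …, τ^(d-1), and φ_θ has a matrix Θ(x), `thetaMatrix`. The polynomials det(t - Θ(x)) and
det(x - `frobMatrix`) arise by eliminating different unknowns from one square system, so they differ
by a constant u ≠ 0 (`exists_det_eq_charpoly`).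

The second determinant is the Frobenius polynomial P. Elements of κ{τ} are linear forms on κ, and
they pair with the H-torsion of the reduction, for H = h^n, into κ[t]/H. The pairing is compatible
with t and with Frobenius. A count of roots of additive polynomials shows that it is perfect, so the
characteristic polynomials on κ{τ} and on the Tate module agree modulo every h^n
(`charpoly_motiveMatrix_map_mk`). This forces the coefficients into A and makes P independent of h
(`exists_frobenius_charpoly`).

The first determinant governs the deformation. Evaluation of 𝔸/f𝔸 at the conjugates θ^(q^m),
weighted by the products of the ℓ_m(z_k), absorbs the factors ℓ_j. Passing from m to m + d
multiplies it by ∏ f(z_k), since ℓ_d(z) becomes f(z). Hence φ_θ on 𝔸/f𝔸 is conjugate to Θ(∏ f(z_k))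
(`thetaMatrix_mul_weightedVandermonde`), and its characteristic polynomial is u P(∏ f(z_k))
(`charpoly_quotAct`). This is the Fitting generator by `isFittingGenerator_aeval'_iff`.

At x = 0 the matrix Θ is triangular with the conjugates of θ on the diagonal, so f = u p_0
(`map_eq_C_mul_coeff_zero`). Comparing leading coefficients puts u in F_q, and u is c(f). -/

/-! ### Elimination in twisted polynomial rings -/

namespace TwistedElimination

/-- The action of a matrix on a vector with entries in a module. -/
def matAct {R N ι κ : Type*} [Fintype κ] [CommRing R] [AddCommGroup N] [Module R N]
    (A : Matrix ι κ R) (v : κ → N) (i : ι) : N :=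
  ∑ j, A i j • v j

theorem matAct_mul {R N ι κ μ : Type*} [Fintype κ] [Fintype μ] [CommRing R] [AddCommGroup N]
    [Module R N] (A : Matrix ι κ R) (B : Matrix κ μ R) (v : μ → N) :
    matAct (A * B) v = matAct A (matAct B v) := by
  ext i
  simp only [matAct, Matrix.mul_apply, Finset.sum_smul, Finset.smul_sum, mul_smul]
  exact Finset.sum_comm

theorem matAct_one {R N ι : Type*} [Fintype ι] [DecidableEq ι] [CommRing R] [AddCommGroup N]
    [Module R N] (v : ι → N) : matAct (1 : Matrix ι ι R) v = v := by
  ext i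
  simp [matAct, Matrix.one_apply]

theorem matAct_sub {R N ι κ : Type*} [Fintype κ] [CommRing R] [AddCommGroup N] [Module R N]
    (A B : Matrix ι κ R) (v : κ → N) : matAct (A - B) v = matAct A v - matAct B v := by
  ext i
  simp [matAct, sub_smul]

theorem matAct_neg_right {R N ι κ : Type*} [Fintype κ] [CommRing R] [AddCommGroup N] [Module R N]
    (A : Matrix ι κ R) (v : κ → N) : matAct A (-v) = -matAct A v := by
  ext i
  simp [matAct]

variable {κ : Type*} [Field κ] (c : ℕ → ℕ → κ) (d s : ℕ)

/-- The coefficient of `τ ^ m` in the relation `∑ j, c i j τ ^ (i + j) - t τ ^ i`. -/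
def rel (i m : ℕ) : κ[X] :=
  (∑ j ∈ Finset.range (s + 1), if i + j = m then C (c i j) else 0) - if i = m then X else 0

theorem rel_of_lt {i m : ℕ} (hs : 0 < s) (h : i + s < m) : rel c s i m = 0 := by
  rw [rel, if_neg (by omega), Finset.sum_eq_zero, sub_zero]
  intro j hj
  rw [if_neg]
  have := Finset.mem_range.1 hj
  omega

theorem rel_top {i : ℕ} (hs : 0 < s) : rel c s i (s + i) = C (c i s) := by
  rw [rel, if_neg (by omega), Finset.sum_eq_single s, sub_zero, if_pos (add_comm _ _)]
  · intro j _ hj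
    rw [if_neg (by omega)]
  · intro h
    simp at h

theorem sum_rel_smul {N : Type*} [AddCommGroup N] [Module κ[X] N] (y : ℕ → N) {i n : ℕ}
    (hi : i + s < n) :
    ∑ m ∈ Finset.range n, rel c s i m • y m
      = ∑ j ∈ Finset.range (s + 1), C (c i j) • y (i + j) - (X : κ[X]) • y i := by
  simp only [rel, sub_smul, Finset.sum_sub_distrib, Finset.sum_smul, ite_smul, zero_smul]
  rw [Finset.sum_comm]
  congr 1
  · refine Finset.sum_congr rfl fun j hj => ?_
    have := Finset.mem_range.1 hj
    rw [Finset.sum_ite_eq, if_pos (Finset.mem_range.2 (by omega))]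
  · rw [Finset.sum_ite_eq, if_pos (Finset.mem_range.2 (by omega))]

/-- The coefficients of `τ ^ m`, `m < s`, in the relations. -/
def low : Matrix (Fin d) (Fin s) κ[X] := Matrix.of fun i j => rel c s i j

/-- The coefficients of `τ ^ (s + m)`, `m < d`, in the relations. -/
def high : Matrix (Fin d) (Fin d) κ[X] := Matrix.of fun i j => rel c s i (s + j)

/-- Row i stops at τ^(s+i), so the matrix is lower triangular with the leading coefficients on its
diagonal. Positivity of s keeps the term -tτ^i away from that diagonal. -/
theorem det_high (hs : 0 < s) : (high c d s).det = C (∏ i : Fin d, c i s) := by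
  rw [Matrix.det_of_isLowerTriangular, map_prod]
  · exact Finset.prod_congr rfl fun i _ => rel_top c s hs
  · intro i j hij
    have : (i : ℕ) < j := hij
    exact rel_of_lt c s hs (by omega)

/-- The coefficients of `τ ^ (d + i)` on `τ ^ j`, `j < s`. -/
def shiftLow (R : Type*) [CommRing R] (d s : ℕ) : Matrix (Fin s) (Fin s) R :=
  Matrix.of fun i j => if d + (i : ℕ) = j then 1 else 0

/-- The coefficients of `τ ^ (d + i)` on `τ ^ (s + j)`, `j < d`. -/
def shiftHigh (R : Type*) [CommRing R] (d s : ℕ) : Matrix (Fin s) (Fin d) R :=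
  Matrix.of fun i j => if d + (i : ℕ) = s + j then 1 else 0

/-- The matrix of right multiplication by `τ ^ d` in the basis `1, τ, …, τ ^ (s - 1)`. -/
def frobMatrix : Matrix (Fin s) (Fin s) κ[X] :=
  shiftLow κ[X] d s - shiftHigh κ[X] d s * (high c d s)⁻¹ * low c d s

theorem isUnit_det_high (hs : 0 < s) (hc : ∀ i, c i s ≠ 0) : IsUnit (high c d s).det := by
  rw [det_high c d s hs]
  exact Polynomial.isUnit_C.2 (IsUnit.mk0 _ (Finset.prod_ne_zero_iff.2 fun i _ => hc i))

/-- The d relations are solved for the d high powers of τ, which is possible because `high` is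
invertible, and the result is substituted into τ^(d+i). The module is left arbitrary so that the
formula applies to linear forms. -/
theorem frobMatrix_spec (hs : 0 < s) (hc : ∀ i, c i s ≠ 0) {N : Type*} [AddCommGroup N]
    [Module κ[X] N] (e : ℕ → N)
    (he : ∀ i, (X : κ[X]) • e i = ∑ j ∈ Finset.range (s + 1), C (c i j) • e (i + j)) (i : Fin s) :
    e (d + i) = ∑ j, frobMatrix c d s i j • e j := by
  have h1 : matAct (high c d s) (fun j : Fin d => e (s + j))
      = -matAct (low c d s) fun j : Fin s => e j := by
    ext i
    rw [Pi.neg_apply, eq_neg_iff_add_eq_zero, add_comm]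
    have := sum_rel_smul c s e (show (i : ℕ) + s < s + d by omega)
    rw [← he, sub_self, ← Fin.sum_univ_eq_sum_range (fun m => rel c s i m • e m),
      Fin.sum_univ_add] at this
    exact this
  have h2 : (fun j : Fin d => e (s + j))
      = -matAct ((high c d s)⁻¹ * low c d s) fun j : Fin s => e j := by
    rw [matAct_mul, ← matAct_neg_right, ← h1, ← matAct_mul,
      Matrix.nonsing_inv_mul _ (isUnit_det_high c d s hs hc), matAct_one]
  have h3 : e (d + i) = matAct (shiftLow κ[X] d s) (fun j : Fin s => e j) i
      + matAct (shiftHigh κ[X] d s) (fun j : Fin d => e (s + j)) i := by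
    have h : ∑ m ∈ Finset.range (s + d), (if d + (i : ℕ) = m then (1 : κ[X]) else 0) • e m
        = e (d + i) := by
      simp only [ite_smul, zero_smul, one_smul]
      rw [Finset.sum_ite_eq, if_pos (Finset.mem_range.2 (by omega))]
    rw [← Fin.sum_univ_eq_sum_range (fun m => (if d + (i : ℕ) = m then (1 : κ[X]) else 0) • e m),
      Fin.sum_univ_add] at h
    exact h.symm
  rw [h3, h2, matAct_neg_right, ← matAct_mul, Pi.neg_apply, ← sub_eq_add_neg, ← Matrix.mul_assoc,
    ← Pi.sub_apply (matAct _ _), ← matAct_sub]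
  rfl

/-- The matrix of right multiplication by `∑ j, c i j τ ^ j` in the basis `1, τ, …, τ ^ (d - 1)`
over the polynomials in `x = τ ^ d`. -/
def thetaMatrix {S : Type*} [CommRing S] (c : ℕ → ℕ → S) (d s : ℕ) (x : S) :
    Matrix (Fin d) (Fin d) S :=
  Matrix.of fun i k => ∑ j ∈ Finset.range (s + 1),
    if ((i : ℕ) + j) % d = k then c i j * x ^ (((i : ℕ) + j) / d) else 0

theorem thetaMatrix_map {S S' : Type*} [CommRing S] [CommRing S'] (g : S →+* S')
    (c : ℕ → ℕ → S) (d s : ℕ) (x : S) :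
    (thetaMatrix c d s x).map g = thetaMatrix (fun i j => g (c i j)) d s (g x) := by
  ext i k
  simp [thetaMatrix, apply_ite g]

theorem det_submatrix_equiv_equiv_associated {R ι κ : Type*} [CommRing R] [Fintype ι]
    [DecidableEq ι] [Fintype κ] [DecidableEq κ] (A : Matrix ι ι R) (e e' : κ ≃ ι) :
    ∃ ε : ℤˣ, (A.submatrix e e').det = (ε : ℤ) * A.det := by
  refine ⟨Equiv.Perm.sign (e'.trans e.symm), ?_⟩
  have : A.submatrix e e' = (A.submatrix e e).submatrix id (e'.trans e.symm) := by
    ext i j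
    simp
  rw [this, Matrix.det_permute', Matrix.det_submatrix_equiv_self]

theorem sum_C_rel_mul (y : ℕ → κ[X][X]) {i n : ℕ} (hi : i + s < n) :
    ∑ m ∈ Finset.range n, C (rel c s i m) * y m
      = ∑ j ∈ Finset.range (s + 1), C (C (c i j)) * y (i + j) - C X * y i := by
  simpa only [smul_eq_C_mul] using sum_rel_smul c s y hi

/-- The full system of relations: the coefficients of `τ ^ m`, `m < s + d`, in the relations
`τ ^ (d + i) - x τ ^ i` and `∑ j, c i j τ ^ (i + j) - t τ ^ i`. -/
def system : Fin s ⊕ Fin d → ℕ → κ[X][X] :=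
  Sum.elim (fun i m => (if d + (i : ℕ) = m then 1 else 0) - if (i : ℕ) = m then X else 0)
    (fun i m => C (rel c s i m))

theorem sum_system_inr (y : ℕ → κ[X][X]) (i : Fin d) :
    ∑ m ∈ Finset.range (d + s), system c d s (Sum.inr i) m * y m
      = ∑ j ∈ Finset.range (s + 1), C (C (c i j)) * y (i + j) - C X * y i :=
  sum_C_rel_mul c s y (by omega)

theorem sum_system_inl (hd : 0 < d) (y : ℕ → κ[X][X]) (i : Fin s) :
    ∑ m ∈ Finset.range (d + s), system c d s (Sum.inl i) m * y m = y (d + i) - X * y i := by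
  simp only [system, Sum.elim_inl, sub_mul, ite_mul, one_mul, zero_mul, Finset.sum_sub_distrib]
  rw [Finset.sum_ite_eq, if_pos (Finset.mem_range.2 (by omega)), Finset.sum_ite_eq,
    if_pos (Finset.mem_range.2 (by omega))]

/-- Substituting x^⌊m/d⌋ τ^(m mod d) for τ^m kills the relations τ^(d+i) - xτ^i and turns the others
into the rows of Θ(x) - t. -/
theorem det_system (hd : 0 < d) :
    (Matrix.of fun i j => system c d s i.swap
        (Sum.elim (fun j : Fin d => (j : ℕ)) (fun j : Fin s => d + (j : ℕ)) j) :
        Matrix (Fin d ⊕ Fin s) (Fin d ⊕ Fin s) κ[X][X]).det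
      = (-1) ^ d * (Matrix.scalar (Fin d) (C X : κ[X][X])
        - thetaMatrix (fun i j => C (C (c i j))) d s X).det := by
  set v' : Fin d ⊕ Fin s → ℕ := Sum.elim (fun j => (j : ℕ)) (fun j => d + (j : ℕ)) with hv'
  set G' : Matrix (Fin d ⊕ Fin s) (Fin d ⊕ Fin s) κ[X][X] :=
    Matrix.of fun i j => system c d s i.swap (v' j) with hG'
  let y : Fin d → ℕ → κ[X][X] := fun k m => if m % d = k then X ^ (m / d) else 0
  -- Unipotent column operations carrying out the substitution: the columns d, …, d+s-1 are folded
  -- back onto the first d.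
  let Z : Matrix (Fin d ⊕ Fin s) (Fin d ⊕ Fin s) κ[X][X] := Matrix.fromBlocks 1 0
    (Matrix.of fun m k => y k (d + m)) 1
  have hZ : Z.det = 1 := by simp [Z]
  have hrow : ∀ i k, (G' * Z) i (Sum.inl k) = ∑ m ∈ Finset.range (d + s), system c d s i.swap m * y k m := by
    intro i k
    rw [← Fin.sum_univ_eq_sum_range (fun m => system c d s i.swap m * y k m), Fin.sum_univ_add,
      Matrix.mul_apply, Fintype.sum_sum_type]
    congr 1
    refine Finset.sum_congr rfl fun j _ => ?_
    simp [G', Z, v', y, Nat.mod_eq_of_lt, Nat.div_eq_of_lt, Matrix.one_apply, Fin.ext_iff]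
  have hR : ∃ R : Matrix (Fin d) (Fin s) κ[X][X], ∃ R' : Matrix (Fin s) (Fin s) κ[X][X],
      R'.det = 1 ∧ G' * Z = Matrix.fromBlocks (-(Matrix.scalar (Fin d) (C X : κ[X][X])
        - thetaMatrix (fun i j => C (C (c i j))) d s X)) R 0 R' := by
    refine ⟨(G' * Z).toBlocks₁₂, (G' * Z).toBlocks₂₂, ?_, ?_⟩
    · have h : ∀ i j, (G' * Z).toBlocks₂₂ i j = (if (i : ℕ) = j then 1 else 0)
          - if (i : ℕ) = d + j then X else 0 := by
        intro i j
        simp [Matrix.toBlocks₂₂, Matrix.mul_apply, Z, G', system, v', Matrix.one_apply]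
        congr
      rw [Matrix.det_of_isLowerTriangular]
      · refine Finset.prod_eq_one fun i _ => ?_
        rw [h, if_pos rfl, if_neg (by omega), sub_zero]
      · intro i j hij
        have : (i : ℕ) < j := hij
        rw [h, if_neg (by omega), if_neg (by omega), sub_zero]
    · rw [← Matrix.fromBlocks_toBlocks (G' * Z), Matrix.fromBlocks_inj]
      refine ⟨?_, rfl, ?_, rfl⟩
      · ext1 i k
        refine (hrow (Sum.inl i) k).trans ((sum_system_inr c d s (y k) i).trans ?_)
        simp only [Matrix.neg_apply, Matrix.sub_apply, neg_sub, thetaMatrix, Matrix.of_apply]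
        congr 1
        · refine Finset.sum_congr rfl fun j _ => ?_
          simp [y]
        · simp [y, Nat.mod_eq_of_lt, Nat.div_eq_of_lt, Matrix.diagonal_apply, Fin.ext_iff]
      · ext1 i k
        refine (hrow (Sum.inr i) k).trans ((sum_system_inl c d s hd (y k) i).trans ?_)
        simp only [y, Nat.add_mod_left, Nat.add_div_left _ hd, pow_succ', Matrix.zero_apply]
        split_ifs <;> simp
  obtain ⟨R, R', hR', hGZ⟩ := hR
  have := congrArg Matrix.det hGZ
  rwa [Matrix.det_mul, hZ, mul_one, Matrix.det_fromBlocks_zero₂₁, hR', mul_one, Matrix.det_neg,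
    Fintype.card_fin] at this

theorem neg_one_pow_mul_neg_one_pow {R : Type*} [CommRing R] (d : ℕ) :
    (-1 : R) ^ d * (-1) ^ d = 1 := by
  rw [← mul_pow, neg_mul_neg, one_mul, one_pow]

/-- The same system has its determinant computed twice: by folding powers of τ modulo τ^d - x, and
by a Schur complement that eliminates the high powers through the relations for t. -/
theorem exists_det_eq_charpoly (hd : 0 < d) (hs : 0 < s) (hc : ∀ i, c i s ≠ 0) :
    ∃ u : κ, u ≠ 0 ∧
      (Matrix.scalar (Fin d) (C X : κ[X][X]) - thetaMatrix (fun i j => C (C (c i j))) d s X).det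
        = C (C u) * (frobMatrix c d s).charpoly := by
  let g := system c d s
  let v : Fin s ⊕ Fin d → ℕ := Sum.elim (fun j => (j : ℕ)) (fun j => s + (j : ℕ))
  let v' : Fin d ⊕ Fin s → ℕ := Sum.elim (fun j => (j : ℕ)) (fun j => d + (j : ℕ))
  let G : Matrix (Fin s ⊕ Fin d) (Fin s ⊕ Fin d) κ[X][X] := Matrix.of fun i j => g i (v j)
  let G' : Matrix (Fin d ⊕ Fin s) (Fin d ⊕ Fin s) κ[X][X] := Matrix.of fun i j => g i.swap (v' j)
  have hGG' : ∃ ε : ℤˣ, G'.det = (ε : ℤ) * G.det := by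
    -- The columns 0, …, s+d-1 are split as s + d in one matrix and as d + s in the other, so the
    -- determinants differ by the sign of a permutation.
    have := det_submatrix_equiv_equiv_associated G (Equiv.sumComm (Fin d) (Fin s))
      ((finSumFinEquiv.trans (finCongr (add_comm d s))).trans finSumFinEquiv.symm)
    convert this using 4
    ext i j : 1
    simp only [G', G, Matrix.of_apply, Matrix.submatrix_apply]
    apply congrArg (g i.swap)
    generalize hk : ((finSumFinEquiv.trans (finCongr (add_comm d s))).trans
      finSumFinEquiv.symm) j = k
    have hk' : finCongr (add_comm d s) (finSumFinEquiv j) = finSumFinEquiv k := by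
      rw [← hk]; simp
    have := congrArg Fin.val hk'
    rcases j with j | j <;> rcases k with k | k <;>
      simpa [v, v', add_comm] using this
  have hG : G.det = C (high c d s).det * ((-1) ^ s * (frobMatrix c d s).charpoly) := by
    have hu := isUnit_det_high c d s hs hc
    have hGb : G = Matrix.fromBlocks
        ((shiftLow κ[X] d s).map C - Matrix.scalar (Fin s) X) ((shiftHigh κ[X] d s).map C)
        ((low c d s).map C) ((high c d s).map C) := by
      ext i j : 2
      rcases i with i | i <;> rcases j with j | j
      · simp [G, g, system, v, shiftLow, Matrix.diagonal_apply, apply_ite C, Fin.ext_iff]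
      · have : (i : ℕ) ≠ s + j := by omega
        simp [G, g, system, v, shiftHigh, apply_ite C, this]
      · simp [G, g, system, v, low]
      · simp [G, g, system, v, high]
    have hinv : ((high c d s)⁻¹.map C : Matrix _ _ κ[X][X]) * (high c d s).map C = 1 := by
      rw [← Matrix.map_mul, Matrix.nonsing_inv_mul _ hu, Matrix.map_one _ C_0 C_1]
    have hinv' : (high c d s).map C * ((high c d s)⁻¹.map C : Matrix _ _ κ[X][X]) = 1 := by
      rw [← Matrix.map_mul, Matrix.mul_nonsing_inv _ hu, Matrix.map_one _ C_0 C_1]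
    let _ : Invertible ((high c d s).map C : Matrix _ _ κ[X][X]) := ⟨_, hinv, hinv'⟩
    -- The Schur complement of the invertible block `high` is `frobMatrix` minus x.
    rw [hGb, Matrix.det_fromBlocks₂₂]
    congr 1
    · exact (RingHom.map_det C _).symm
    · have : ((shiftLow κ[X] d s).map C - Matrix.scalar (Fin s) X
          - (shiftHigh κ[X] d s).map C * ⅟((high c d s).map C) * (low c d s).map C : Matrix _ _ κ[X][X])
          = -(frobMatrix c d s).charmatrix := by
        have h : (⅟((high c d s).map C) : Matrix _ _ κ[X][X]) = (high c d s)⁻¹.map C := rfl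
        rw [h, ← Matrix.map_mul, ← Matrix.map_mul, Matrix.charmatrix, frobMatrix, map_sub]
        simp only [RingHom.mapMatrix_apply]
        abel
      rw [this, Matrix.det_neg, Fintype.card_fin, Matrix.charpoly]
  have hG' := det_system c d s hd
  obtain ⟨ε, hε⟩ := hGG'
  -- The signs come from Θ - t, from the column permutation and from `frobMatrix` - x; the product
  -- is the determinant of `high`.
  refine ⟨(-1) ^ d * ((ε : ℤ) * (-1) ^ s * ∏ i : Fin d, c i s), ?_, ?_⟩
  · have : (((ε : ℤ) : κ)) ≠ 0 := by
      rcases Int.units_eq_one_or ε with h | h <;> simp [h]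
    have h1 : ∏ i : Fin d, c i s ≠ 0 := Finset.prod_ne_zero_iff.2 fun i _ => hc i
    simp [this, h1]
  · rw [hG', hG, det_high c d s hs] at hε
    have h2 : ((-1 : κ[X][X]) ^ d) * (-1) ^ d = 1 := neg_one_pow_mul_neg_one_pow d
    calc _ = ((-1 : κ[X][X]) ^ d) * ((-1) ^ d * _) := by rw [← mul_assoc, h2, one_mul]
      _ = _ := by
        rw [hε]
        simp only [C_mul, C_pow, C_neg, C_1, ← C_eq_intCast]
        ring

end TwistedElimination

/-! ### Fitting generators and characteristic polynomials -/

theorem Matrix.charpoly_blockDiagonal' {R ι : Type*} [CommRing R] [Fintype ι] [LinearOrder ι]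
    {m : ι → Type*} [∀ i, Fintype (m i)] [∀ i, DecidableEq (m i)]
    (A : ∀ i, Matrix (m i) (m i) R) :
    (Matrix.blockDiagonal' A).charpoly = ∏ i, (A i).charpoly := by
  have : (Matrix.blockDiagonal' A).charmatrix = Matrix.blockDiagonal' fun i => (A i).charmatrix := by
    ext1 ⟨i, a⟩ ⟨j, b⟩
    by_cases h : i = j
    · subst h
      simp [Matrix.charmatrix_apply, Matrix.blockDiagonal'_apply, Matrix.diagonal_apply]
    · have : (⟨i, a⟩ : Σ i, m i) ≠ ⟨j, b⟩ := fun h' => h (congrArg Sigma.fst h')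
      simp [Matrix.blockDiagonal'_apply, h]
  rw [Matrix.charpoly, this, (Matrix.blockTriangular_blockDiagonal' _).det_fintype]
  refine Finset.prod_congr rfl fun i _ => ?_
  let e : m i ≃ { x : Σ i, m i // x.1 = i } :=
    { toFun := fun a => ⟨⟨i, a⟩, rfl⟩
      invFun := fun x => x.2 ▸ x.1.2
      left_inv := fun _ => rfl
      right_inv := by rintro ⟨⟨_, _⟩, rfl⟩; rfl }
  rw [← Matrix.det_submatrix_equiv_self e, Matrix.charpoly]
  congr 1
  ext1 a b
  simp [e, Matrix.toSquareBlock_def, Matrix.blockDiagonal'_apply]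

section

variable {k V : Type*} [Field k] [AddCommGroup V] [Module k V] [Module.Finite k V]

/-- In the power bases of the summands, the endomorphism is block diagonal, each block being
multiplication by the root in k[X]/(F i). Its characteristic polynomial is the minimal polynomial of
the root, namely F i. -/
theorem charpoly_eq_prod_of_equiv (T : V →ₗ[k] V) {ι : Type*} [Fintype ι] [LinearOrder ι]
    (F : ι → k[X]) (hF : ∀ i, (F i).Monic)
    (e : Module.AEval' T ≃ₗ[k[X]] ∀ i, k[X] ⧸ Ideal.span {F i}) : T.charpoly = ∏ i, F i := by
  let g : V ≃ₗ[k] ∀ i, AdjoinRoot (F i) :=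
    (Module.AEval'.of T).trans (e.restrictScalars k)
  have hg : ∀ v, g (T v) = fun i => AdjoinRoot.root (F i) * g v i := by
    intro v
    change e (Module.AEval'.of T (T v)) = _
    rw [← Module.AEval'.X_smul_of, map_smul]
    rfl
  let b := Pi.basis fun i => (AdjoinRoot.powerBasis' (hF i)).basis
  have hb : LinearMap.toMatrix (b.map g.symm) (b.map g.symm) T
      = Matrix.blockDiagonal' fun i => Algebra.leftMulMatrix (AdjoinRoot.powerBasis' (hF i)).basis
        (AdjoinRoot.powerBasis' (hF i)).gen := by
    ext ⟨i, x⟩ ⟨j, y⟩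
    rw [LinearMap.toMatrix_apply, Module.Basis.map_apply, Module.Basis.map_repr,
      LinearEquiv.trans_apply, LinearEquiv.symm_symm, hg, LinearEquiv.apply_symm_apply,
      Pi.basis_repr, Matrix.blockDiagonal'_apply]
    by_cases h : i = j
    · subst h
      rw [dif_pos rfl, Algebra.leftMulMatrix_eq_repr_mul, Pi.basis_apply]
      simp
    · rw [dif_neg h, Pi.basis_apply]
      simp [Pi.single_eq_of_ne h]
  rw [← LinearMap.charpoly_toMatrix T (b.map g.symm), hb, Matrix.charpoly_blockDiagonal']
  refine Finset.prod_congr rfl fun i _ => ?_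
  rw [charpoly_leftMulMatrix, AdjoinRoot.powerBasis'_gen, AdjoinRoot.minpoly_root (hF i).ne_zero,
    (hF i).leadingCoeff]
  simp

theorem isTorsion_aeval' (T : V →ₗ[k] V) : Module.IsTorsion k[X] (Module.AEval' T) := by
  intro x
  refine ⟨⟨T.charpoly, mem_nonZeroDivisors_of_ne_zero T.charpoly_monic.ne_zero⟩, ?_⟩
  apply (Module.AEval'.of T).symm.injective
  rw [Submonoid.mk_smul, Module.AEval.of_symm_smul, LinearMap.aeval_self_charpoly]
  simp

theorem exists_aeval'_equiv (T : V →ₗ[k] V) :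
    ∃ (m : ℕ) (F : Fin m → k[X]), (∀ i, (F i).Monic) ∧
      Nonempty (Module.AEval' T ≃ₗ[k[X]] DirectSum (Fin m) fun i => k[X] ⧸ Ideal.span {F i}) := by
  classical
  obtain ⟨ι, _, p, hp, e, ⟨E⟩⟩ := Module.equiv_directSum_of_isTorsion (isTorsion_aeval' T)
  let σ := Fintype.equivFin ι
  let F : ι → k[X] := fun i => normalize (p i ^ e i)
  have hspan : ∀ i, (k[X] ∙ p i ^ e i) = Ideal.span {F i} := fun i => by
    rw [Ideal.submodule_span_eq, Ideal.span_singleton_eq_span_singleton]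
    exact associated_normalize _
  refine ⟨Fintype.card ι, fun j => F (σ.symm j), fun j =>
    Polynomial.monic_normalize (pow_ne_zero _ (hp _).ne_zero), ⟨?_⟩⟩
  let e₁ := DirectSum.linearEquivFunOnFintype k[X] ι fun i => k[X] ⧸ (k[X] ∙ p i ^ e i)
  let e₂ := DirectSum.linearEquivFunOnFintype k[X] (Fin (Fintype.card ι))
    fun j => k[X] ⧸ Ideal.span {F (σ.symm j)}
  let e₃ : (∀ i, k[X] ⧸ (k[X] ∙ p i ^ e i)) ≃ₗ[k[X]] ∀ i, k[X] ⧸ Ideal.span {F i} :=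
    LinearEquiv.piCongrRight fun i => Submodule.quotEquivOfEq _ _ (hspan i)
  let e₄ := LinearEquiv.piCongrLeft' k[X] (fun i => k[X] ⧸ Ideal.span {F i}) σ
  exact E.trans <| e₁.trans (e₃.trans (e₄.trans e₂.symm))

/-- Existence comes from the structure theorem for torsion modules over k[X]; uniqueness holds
because every admissible product computes the same characteristic polynomial. -/
theorem isFittingGenerator_aeval'_iff (T : V →ₗ[k] V) (g : k[X]) :
    IsFittingGenerator (Module.AEval' T) g ↔ g = T.charpoly := by
  have key : ∀ (m : ℕ) (F : Fin m → k[X]), (∀ i, (F i).Monic) →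
      (Module.AEval' T ≃ₗ[k[X]] DirectSum (Fin m) fun i => k[X] ⧸ Ideal.span {F i}) →
      T.charpoly = ∏ i, F i := fun m F hF e =>
    charpoly_eq_prod_of_equiv T F hF (e.trans (DirectSum.linearEquivFunOnFintype k[X] (Fin m) _))
  constructor
  · rintro ⟨m, F, hF, ⟨e⟩, rfl⟩
    exact (key m F hF e).symm
  · rintro rfl
    obtain ⟨m, F, hF, ⟨e⟩⟩ := exists_aeval'_equiv T
    exact ⟨m, F, hF, ⟨e⟩, key m F hF e⟩

end

/-! ### Bases of Tate modules of divisible modules -/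

namespace TateModule

variable {R : Type*} [CommRing R] {h : R} {M : Type*} [AddCommGroup M] [Module R M]

theorem exists_lift (hdiv : ∀ y : M, ∃ x, h • x = y) {e : M} (he : h • e = 0) :
    ∃ x : TateModule h M, x.1 1 = e := by
  choose g hg using hdiv
  -- Component 0 must vanish, so e sits at index 1 and successive division by h starts from there.
  let x : ℕ → M := fun n => Nat.rec 0 (fun n _ => g^[n] e) n
  have hx : ∀ n, h • x (n + 1) = x n := by
    rintro (_ | n)
    · exact he
    · change h • g^[n + 1] e = g^[n] e
      rw [Function.iterate_succ_apply', hg]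
  refine ⟨⟨x, fun n => ?_, hx⟩, rfl⟩
  induction n with
  | zero => exact smul_zero _
  | succ n ih => rw [pow_succ, mul_smul, hx, ih]

theorem pow_smul_apply_add (x : TateModule h M) (n m : ℕ) : h ^ m • x.1 (n + m) = x.1 n := by
  induction m with
  | zero => simp
  | succ m ih => rw [pow_succ, mul_smul, ← add_assoc, x.2.2, ih]

variable {ι : Type*} [Fintype ι]

/-- Multiplying by h drops the relation to level n, so h^n divides every coefficient. After this
factor is moved onto the points, a relation between first components remains. -/
theorem dvd_of_sum_smul_eq_zero (x : ι → TateModule h M)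
    (hind : ∀ a : ι → R, ∑ i, a i • (x i).1 1 = 0 → ∀ i, h ∣ a i) (n : ℕ) (a : ι → R)
    (ha : ∑ i, a i • (x i).1 n = 0) (i : ι) : h ^ n ∣ a i := by
  induction n generalizing a i with
  | zero => simp
  | succ n ih =>
    have h1 : ∀ i, h ^ n ∣ a i := by
      intro i
      apply ih
      have := congrArg (h • ·) ha
      simpa only [Finset.smul_sum, smul_comm h, (x _).2.2, smul_zero] using this
    choose b hb using h1
    have h2 : ∑ i, b i • (x i).1 1 = 0 := by
      rw [← ha]
      refine Finset.sum_congr rfl fun i _ => ?_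
      rw [hb, mul_comm, mul_smul, add_comm n 1, pow_smul_apply_add]
    rw [hb, pow_succ]
    exact mul_dvd_mul_left _ (hind b h2 i)

/-- The multiple h^n y is h-torsion, hence a combination of first components. Subtracting the same
combination of components at level n + 1 leaves a point killed by h^n. -/
theorem exists_eq_sum_smul (x : ι → TateModule h M)
    (hspan : ∀ y : M, h • y = 0 → ∃ a : ι → R, y = ∑ i, a i • (x i).1 1) (n : ℕ) (y : M)
    (hy : h ^ n • y = 0) : ∃ a : ι → R, y = ∑ i, a i • (x i).1 n := by
  induction n generalizing y with
  | zero =>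
    have : ∀ i, (x i).1 0 = 0 := fun i => by simpa using (x i).2.1 0
    exact ⟨0, by simpa using hy⟩
  | succ n ih =>
    obtain ⟨b, hb⟩ := hspan (h ^ n • y) (by rw [← mul_smul, ← pow_succ', hy])
    obtain ⟨c, hc⟩ := ih (y - ∑ i, b i • (x i).1 (n + 1)) (by
      rw [smul_sub, hb, sub_eq_zero, Finset.smul_sum]
      refine Finset.sum_congr rfl fun i _ => ?_
      rw [smul_comm, add_comm n 1, pow_smul_apply_add])
    refine ⟨fun i => b i + c i * h, ?_⟩
    rw [sub_eq_iff_eq_add'] at hc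
    rw [hc, ← Finset.sum_add_distrib]
    refine Finset.sum_congr rfl fun i _ => ?_
    rw [add_smul, mul_smul, (x i).2.2]

theorem sum_completion_smul_val (a : ι → HCompletion h) (x : ι → TateModule h M) (n : ℕ) :
    (∑ i, a i • x i).1 n = ∑ i, rep (a i) n • (x i).1 n := by
  rw [Submodule.coe_sum, Finset.sum_apply]
  rfl

/-- Elements of the Tate module of a divisible module whose first components form a basis of the
`h`-torsion form a basis of the Tate module. -/
theorem exists_basis (x : ι → TateModule h M)
    (hind : ∀ a : ι → R, ∑ i, a i • (x i).1 1 = 0 → ∀ i, h ∣ a i)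
    (hspan : ∀ y : M, h • y = 0 → ∃ a : ι → R, y = ∑ i, a i • (x i).1 1) :
    ∃ b : Module.Basis ι (HCompletion h) (TateModule h M), ∀ i, b i = x i := by
  have hli : LinearIndependent (HCompletion h) x := by
    rw [Fintype.linearIndependent_iff]
    intro a ha i
    apply AdicCompletion.ext_evalₐ
    intro n
    have h1 : ∑ i, rep (a i) n • (x i).1 n = 0 := by
      rw [← sum_completion_smul_val, ha]
      rfl
    have h2 := dvd_of_sum_smul_eq_zero x hind n _ h1 i
    rw [← mk_rep, map_zero, Ideal.Quotient.eq_zero_iff_mem, Ideal.span_singleton_pow,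
      Ideal.mem_span_singleton]
    exact h2
  have hsp : ⊤ ≤ Submodule.span (HCompletion h) (Set.range x) := by
    intro y _
    -- Coefficients at level n are unique modulo h^n, so these independent choices form Cauchy
    -- sequences and define elements of the completion.
    choose a ha using fun n => exists_eq_sum_smul x hspan n (y.1 n) (y.2.1 n)
    have hcomp : ∀ n i, a n i ≡ a (n + 1) i [SMOD (Ideal.span {h} ^ n • ⊤ : Submodule R R)] := by
      intro n i
      rw [SModEq.sub_mem, smul_eq_mul, Ideal.mul_top, Ideal.span_singleton_pow,
        Ideal.mem_span_singleton]
      refine dvd_of_sum_smul_eq_zero x hind n (fun i => a n i - a (n + 1) i) ?_ i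
      simp only [sub_smul, Finset.sum_sub_distrib]
      rw [← ha, sub_eq_zero, ← y.2.2, ha, Finset.smul_sum]
      refine Finset.sum_congr rfl fun i _ => ?_
      rw [smul_comm, (x i).2.2]
    let A : ι → HCompletion h := fun i =>
      AdicCompletion.mk (Ideal.span {h}) R (AdicCompletion.AdicCauchySequence.mk _ _ (fun n => a n i)
        fun n => hcomp n i)
    have hy : y = ∑ i, A i • x i := by
      ext n
      rw [sum_completion_smul_val, ha]
      refine Finset.sum_congr rfl fun i _ => ?_
      exact (rep_smul_eq (x i) (A i) n (AdicCompletion.evalₐ_mk _ n _).symm).symm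
    rw [hy]
    exact Submodule.sum_mem _ fun i _ => Submodule.smul_mem _ _ (Submodule.subset_span ⟨i, rfl⟩)
  exact ⟨Module.Basis.mk hli hsp, fun i => Module.Basis.mk_apply hli hsp i⟩

/-- The matrix of the endomorphism of the Tate module induced by `u` describes `u` modulo `h ^ n`. -/
theorem map_apply_eq_sum [DecidableEq ι] (b : Module.Basis ι (HCompletion h) (TateModule h M))
    (u : M →ₗ[R] M) (n : ℕ) (j : ι) :
    u ((b j).1 n) = ∑ i, rep (LinearMap.toMatrix b b (map u) i j) n • (b i).1 n := by
  have h1 : map u (b j) = ∑ i, LinearMap.toMatrix b b (map u) i j • b i := by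
    simp only [LinearMap.toMatrix_apply]
    exact (b.sum_repr _).symm
  rw [← sum_completion_smul_val, ← h1]
  rfl

theorem evalₐ_charpoly [DecidableEq ι] (A : Matrix ι ι (HCompletion h)) (n : ℕ) :
    A.charpoly.map (AdicCompletion.evalₐ (Ideal.span {h}) n : HCompletion h →+* _)
      = (Matrix.of fun i j => rep (A i j) n).charpoly.map (Ideal.Quotient.mk (Ideal.span {h} ^ n)) := by
  rw [← Matrix.charpoly_map, ← Matrix.charpoly_map]
  congr 1
  ext1 i j
  exact (mk_rep _ _).symm

end TateModule

/-! ### Polynomials in an additive polynomial under composition -/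

namespace AdditiveAction

theorem natDegree_sum_of_strictMono {κ : Type*} [Field κ] (w : ℕ → κ[X])
    (hw : StrictMono fun i => (w i).natDegree) (a : ℕ → κ) (n : ℕ) (ha : a n ≠ 0) :
    (∑ i ∈ Finset.range (n + 1), C (a i) * w i).natDegree = (w n).natDegree := by
  have htop : (C (a n) * w n).natDegree = (w n).natDegree := natDegree_C_mul ha
  rcases Nat.eq_zero_or_pos n with rfl | hn
  · rw [Finset.sum_range_one, htop]
  · rw [Finset.sum_range_succ, natDegree_add_eq_right_of_natDegree_lt, htop]
    rw [htop]
    have h0 : 0 < (w n).natDegree := (Nat.zero_le _).trans_lt (hw hn)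
    refine (natDegree_sum_le_of_forall_le _ _ (n := (w n).natDegree - 1) fun i hi => ?_).trans_lt
      (by omega)
    have := hw (Finset.mem_range.1 hi)
    exact (natDegree_C_mul_le _ _).trans (Nat.le_sub_one_of_lt this)

variable {κ : Type*} [Field κ] (p : κ[X])

/-- The polynomial `∑ gₗ (p ∘ ⋯ ∘ p) ^ e`, with `p` composed `l` times with itself. -/
def iterSum (g : κ[X]) (e : ℕ) : κ[X] :=
  ∑ l ∈ Finset.range (g.natDegree + 1), C (g.coeff l) * (p.comp^[l] X) ^ e

theorem natDegree_iterSum (hp : 1 < p.natDegree) {g : κ[X]} (hg : g ≠ 0) {e : ℕ} (he : 0 < e) :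
    (iterSum p g e).natDegree = p.natDegree ^ g.natDegree * e := by
  have hw : ∀ l, ((p.comp^[l] X) ^ e).natDegree = p.natDegree ^ l * e := fun l => by
    rw [natDegree_pow, natDegree_iterate_comp, natDegree_X, mul_one, mul_comm]
  rw [iterSum, natDegree_sum_of_strictMono (fun l => (p.comp^[l] X) ^ e), hw]
  · intro i j hij
    simp only [hw]
    exact Nat.mul_lt_mul_of_pos_right (Nat.pow_lt_pow_right hp hij) he
  · exact leadingCoeff_ne_zero.2 hg

theorem derivative_iterate_comp {θ : κ} (hp : derivative p = C θ) (l : ℕ) :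
    derivative (p.comp^[l] X) = C (θ ^ l) := by
  induction l with
  | zero => simp
  | succ l ih => rw [Function.iterate_succ_apply', derivative_comp, ih, hp]; simp [pow_succ]

theorem derivative_iterSum {θ : κ} (hp : derivative p = C θ) (g : κ[X]) :
    derivative (iterSum p g 1) = C (g.eval θ) := by
  simp only [iterSum, pow_one, derivative_sum, derivative_C_mul, derivative_iterate_comp p hp]
  rw [eval_eq_sum_range, map_sum]
  simp

theorem eval_iterSum {Fq : Type*} [Field Fq] [Algebra Fq κ] (T : κ →ₗ[Fq] κ)
    (hT : ∀ x, p.eval x = T x) (g : κ[X]) (e : ℕ) (x : κ) :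
    (iterSum p g e).eval x = ∑ l ∈ Finset.range (g.natDegree + 1), g.coeff l * ((T ^ l) x) ^ e := by
  have : (fun x => p.eval x) = T := funext hT
  simp only [iterSum, eval_finsetSum, eval_mul, eval_C, eval_pow, iterate_comp_eval, eval_X, this,
    Module.End.pow_apply]

theorem eval_iterSum_map {Fq : Type*} [Field Fq] [Algebra Fq κ] (T : κ →ₗ[Fq] κ)
    (hT : ∀ x, p.eval x = T x) (H : Fq[X]) (x : κ) :
    (iterSum p (H.map (algebraMap Fq κ)) 1).eval x = aeval T H x := by
  rw [eval_iterSum p T hT, aeval_eq_sum_range, natDegree_map, LinearMap.sum_apply]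
  simp [Algebra.smul_def]

section

variable [IsAlgClosed κ] {Fq : Type*} [Field Fq] [Algebra Fq κ] (T : κ →ₗ[Fq] κ) {θ : κ}

theorem exists_aeval_apply_eq (hT : ∀ x, p.eval x = T x) (hp : 1 < p.natDegree) {H : Fq[X]}
    (hH : H ≠ 0) (y : κ) : ∃ x, aeval T H x = y := by
  have hH' : H.map (algebraMap Fq κ) ≠ 0 := map_ne_zero hH
  have hdeg := natDegree_iterSum p hp hH' one_pos
  obtain ⟨x, hx⟩ := IsAlgClosed.exists_root (iterSum p (H.map (algebraMap Fq κ)) 1 - C y) (by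
    rw [degree_sub_C]
    · exact (natDegree_pos_iff_degree_pos.1 (by rw [hdeg]; positivity)).ne'
    · exact natDegree_pos_iff_degree_pos.1 (by rw [hdeg]; positivity))
  exact ⟨x, by rwa [IsRoot.def, eval_sub, eval_C, eval_iterSum_map p T hT, sub_eq_zero] at hx⟩

/-- The polynomial inducing H(T) has constant derivative H(θ) ≠ 0, so it is separable and has as
many roots as its degree. -/
theorem exists_finset_ker (hT : ∀ x, p.eval x = T x) (hp : 1 < p.natDegree)
    (hp' : derivative p = C θ) {H : Fq[X]} (hH : aeval θ H ≠ 0) :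
    ∃ s : Finset κ, (∀ x, x ∈ s ↔ aeval T H x = 0) ∧ s.card = p.natDegree ^ H.natDegree := by
  classical
  have hH0 : H ≠ 0 := by
    rintro rfl
    simp at hH
  have hH' : H.map (algebraMap Fq κ) ≠ 0 := map_ne_zero hH0
  have hdeg := natDegree_iterSum p hp hH' one_pos
  rw [natDegree_map, mul_one] at hdeg
  set P := iterSum p (H.map (algebraMap Fq κ)) 1 with hP
  have hder : derivative P = C (aeval θ H) := by
    rw [hP, derivative_iterSum p hp', eval_map_algebraMap]
  have hsep : P.Separable := by
    rw [separable_def, hder]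
    exact (isCoprime_one_right).of_isCoprime_of_dvd_right
      (Polynomial.isUnit_C.2 (IsUnit.mk0 _ hH)).dvd
  have hP0 : P ≠ 0 := by
    intro h
    rw [h, natDegree_zero] at hdeg
    exact absurd hdeg.symm (by positivity)
  refine ⟨P.roots.toFinset, fun x => ?_, ?_⟩
  · rw [Multiset.mem_toFinset, mem_roots hP0, IsRoot.def, eval_iterSum_map p T hT]
  · rw [Multiset.toFinset_card_of_nodup (nodup_roots hsep), IsAlgClosed.card_roots_eq_natDegree,
      hdeg]

/-- A combination of low degree of the maps `x ↦ (∑ gₗ Tˡ x) ^ (q ^ i)` which vanishes on the kernel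
of `H(T)` is trivial. -/
theorem eq_zero_of_forall_ker (hT : ∀ x, p.eval x = T x) {q s : ℕ} (hq : 1 < q) (hs : 0 < s)
    (hp : p.natDegree = q ^ s) (hp' : derivative p = C θ) {H : Fq[X]} (hH : aeval θ H ≠ 0)
    {g : κ[X]} (hg : g ≠ 0) (hgH : g.natDegree < H.natDegree) (v : Fin s → κ)
    (hv : ∀ x, aeval T H x = 0 → ∑ i : Fin s, v i * ∑ l ∈ Finset.range (g.natDegree + 1),
      g.coeff l * ((T ^ l) x) ^ q ^ (i : ℕ) = 0) : v = 0 := by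
  have hp1 : 1 < p.natDegree := hp ▸ Nat.one_lt_pow hs.ne' hq
  have hw : ∀ i, (iterSum p g (q ^ i)).natDegree = q ^ (s * g.natDegree + i) := fun i => by
    rw [natDegree_iterSum p hp1 hg (by positivity), hp, ← pow_mul, ← pow_add]
  have hmono : StrictMono fun i => (iterSum p g (q ^ i)).natDegree := fun i j hij => by
    simp only [hw]
    exact Nat.pow_lt_pow_right hq (by omega)
  classical
  by_contra hne
  -- Extension by zero, so that the largest index with a nonzero coefficient is below s.
  let a : ℕ → κ := fun i => if h : i < s then v ⟨i, h⟩ else 0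
  have ha : ∀ i : Fin s, a i = v i := fun i => dif_pos i.2
  obtain ⟨i₀, hi₀⟩ := Function.ne_iff.1 hne
  let n := Nat.findGreatest (fun i => a i ≠ 0) s
  have hn : a n ≠ 0 := Nat.findGreatest_spec (P := fun i => a i ≠ 0) i₀.2.le (by rwa [ha])
  have hns : n < s := by
    by_contra h
    exact hn (dif_neg h)
  have hlarge : ∀ i, n < i → i < s → a i = 0 := fun i h1 h2 => by
    by_contra h
    exact Nat.findGreatest_is_greatest h1 h2.le h
  let G := ∑ i ∈ Finset.range (n + 1), C (a i) * iterSum p g (q ^ i)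
  have hGdeg : G.natDegree = q ^ (s * g.natDegree + n) := by
    rw [← hw]
    exact natDegree_sum_of_strictMono _ hmono a n hn
  obtain ⟨S, hS, hcard⟩ := exists_finset_ker p T hT hp1 hp' hH
  have hG : G = ∑ i : Fin s, C (v i) * iterSum p g (q ^ (i : ℕ)) := by
    simp only [← ha]
    rw [Fin.sum_univ_eq_sum_range (fun i => C (a i) * iterSum p g (q ^ i))]
    refine Finset.sum_subset (Finset.range_subset_range.2 hns) fun i h1 h2 => ?_
    rw [hlarge i (by simpa using h2) (Finset.mem_range.1 h1), C_0, zero_mul]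
  -- The kernel of H(T) has q^(s deg H) points, while deg G = q^(s deg g + n) with n < s and deg g <
  -- deg H: too many roots.
  have hG0 : G = 0 := by
    refine eq_zero_of_natDegree_lt_card_of_eval_eq_zero' G S (fun x hx => ?_) ?_
    · rw [hG, eval_finsetSum, ← hv x ((hS x).1 hx)]
      simp only [eval_mul, eval_C, eval_iterSum p T hT]
    · rw [hcard, hGdeg, hp, ← pow_mul]
      refine Nat.pow_lt_pow_right hq ?_
      calc s * g.natDegree + n < s * g.natDegree + s := by omega
        _ = s * (g.natDegree + 1) := by ring
        _ ≤ s * H.natDegree := Nat.mul_le_mul_left _ hgH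
  rw [hG0, natDegree_zero] at hGdeg
  exact absurd hGdeg.symm (by positivity)

end

end AdditiveAction

/-! ### The pairing between torsion points and linear forms -/

namespace TorsionPairing

section DividedDifference

variable {κ : Type*} [Field κ]

/-- The polynomial `∑_{e < j} y e * X ^ (j - 1 - e)`. -/
def powDivDiff : ℕ → (ℕ → κ) →ₗ[κ] κ[X]
  | 0 => 0
  | j + 1 => LinearMap.mulLeft κ X ∘ₗ powDivDiff j + monomial 0 ∘ₗ LinearMap.proj j

theorem powDivDiff_succ (j : ℕ) (y : ℕ → κ) :
    powDivDiff (j + 1) y = X * powDivDiff j y + C (y j) := rfl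

theorem powDivDiff_shift (j : ℕ) (y : ℕ → κ) :
    powDivDiff j (fun e => y (e + 1)) = X * powDivDiff j y - C (y 0) * X ^ j + C (y j) := by
  induction j with
  | zero => simp [powDivDiff]
  | succ j ih =>
    rw [powDivDiff_succ, ih, powDivDiff_succ]
    ring

theorem degree_powDivDiff_lt (j : ℕ) (y : ℕ → κ) : (powDivDiff j y).degree < j := by
  rw [degree_lt_iff_coeff_zero]
  induction j with
  | zero => simp [powDivDiff]
  | succ j ih =>
    intro m hm
    obtain ⟨m, rfl⟩ := Nat.exists_eq_add_of_lt hm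
    rw [powDivDiff_succ, coeff_add, coeff_X_mul, coeff_C_succ, add_zero]
    exact ih _ (by omega)

theorem coeff_powDivDiff_succ (j : ℕ) (y : ℕ → κ) : (powDivDiff (j + 1) y).coeff j = y 0 := by
  induction j with
  | zero => simp [powDivDiff]
  | succ j ih => rw [powDivDiff_succ, coeff_add, coeff_X_mul, ih, coeff_C_succ, add_zero]

/-- The polynomial `∑ⱼ Hⱼ ∑_{e < j} y e * X ^ (j - 1 - e)`: the result of applying the linear form
`T ^ e ↦ y e` to `(H(X) - H(T)) / (X - T)`. -/
def divDiff (H : κ[X]) : (ℕ → κ) →ₗ[κ] κ[X] :=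
  ∑ j ∈ Finset.range (H.natDegree + 1), H.coeff j • powDivDiff j

theorem divDiff_apply (H : κ[X]) (y : ℕ → κ) :
    divDiff H y = ∑ j ∈ Finset.range (H.natDegree + 1), C (H.coeff j) * powDivDiff j y := by
  simp [divDiff, LinearMap.sum_apply, smul_eq_C_mul]

/-- With D = (H(X) - H(T))/(X - T), this is the identity T D = X D - H(X) + H(T) after applying the
linear form. -/
theorem divDiff_shift (H : κ[X]) (y : ℕ → κ) :
    divDiff H (fun e => y (e + 1)) = X * divDiff H y - C (y 0) * H
      + C (∑ j ∈ Finset.range (H.natDegree + 1), H.coeff j * y j) := by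
  have h : C (y 0) * H = ∑ j ∈ Finset.range (H.natDegree + 1), C (H.coeff j) * (C (y 0) * X ^ j) := by
    conv_lhs => rw [H.as_sum_range_C_mul_X_pow]
    rw [Finset.mul_sum]
    exact Finset.sum_congr rfl fun j _ => by ring
  rw [h, map_sum, divDiff_apply, divDiff_apply, Finset.mul_sum, ← Finset.sum_sub_distrib,
    ← Finset.sum_add_distrib]
  refine Finset.sum_congr rfl fun j _ => ?_
  rw [powDivDiff_shift, C_mul]
  ring

theorem degree_divDiff_lt {H : κ[X]} (hH : H ≠ 0) (y : ℕ → κ) :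
    (divDiff H y).degree < H.degree := by
  rw [divDiff_apply, degree_eq_natDegree hH]
  refine (degree_sum_le _ _).trans_lt ((Finset.sup_lt_iff (WithBot.bot_lt_coe _)).2 fun j hj => ?_)
  have hj' : j ≤ H.natDegree := by simpa [Nat.lt_succ_iff] using hj
  calc _ ≤ (powDivDiff j y).degree := by
        rw [← smul_eq_C_mul]
        exact degree_smul_le _ _
    _ < j := degree_powDivDiff_lt j y
    _ ≤ H.natDegree := by exact_mod_cast hj'

theorem coeff_divDiff {H : κ[X]} {D : ℕ} (hD : H.natDegree = D + 1) (y : ℕ → κ) :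
    (divDiff H y).coeff D = H.leadingCoeff * y 0 := by
  rw [divDiff_apply, finsetSum_coeff, Finset.sum_eq_single (D + 1)]
  · rw [coeff_C_mul, coeff_powDivDiff_succ, leadingCoeff, hD]
  · intro j hj hne
    have hj' : j ≤ D := by
      have := Finset.mem_range.1 hj
      omega
    rw [coeff_C_mul, coeff_eq_zero_of_degree_lt ((degree_powDivDiff_lt j y).trans_le _), mul_zero]
    exact_mod_cast hj'
  · intro h
    simp [hD] at h

/-- The divided difference has degree below that of H, so divisibility forces it to vanish; its top
coefficient is a nonzero multiple of y 0. -/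
theorem eq_zero_of_dvd_divDiff {H : κ[X]} (hH : 0 < H.natDegree) (y : ℕ → κ)
    (h : H ∣ divDiff H y) : y 0 = 0 := by
  have hH0 : H ≠ 0 := by
    rintro rfl
    simp at hH
  obtain ⟨D, hD⟩ := Nat.exists_eq_succ_of_ne_zero hH.ne'
  have h0 := eq_zero_of_dvd_of_degree_lt h (degree_divDiff_lt hH0 y)
  have h1 := coeff_divDiff hD y
  rw [h0, coeff_zero, eq_comm, mul_eq_zero] at h1
  exact h1.resolve_left (leadingCoeff_ne_zero.2 hH0)

end DividedDifference

section Pairing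

variable {Fq κ V : Type*} [Field Fq] [Field κ] [Algebra Fq κ] [AddCommGroup V] [Module Fq V]

/-- Composition of linear forms with an endomorphism. -/
def precomp (κ : Type*) [Field κ] [Algebra Fq κ] (u : V →ₗ[Fq] V) :
    (V →ₗ[Fq] κ) →ₗ[κ] (V →ₗ[Fq] κ) where
  toFun l := l ∘ₗ u
  map_add' _ _ := rfl
  map_smul' _ _ := rfl

theorem precomp_pow_apply (u : V →ₗ[Fq] V) (j : ℕ) (l : V →ₗ[Fq] κ) (x : V) :
    (precomp κ u ^ j) l x = l ((u ^ j) x) := by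
  induction j generalizing l with
  | zero => rfl
  | succ j ih =>
    rw [pow_succ, Module.End.mul_apply, ih, pow_succ', Module.End.mul_apply]
    rfl

theorem aeval_precomp_apply (u : V →ₗ[Fq] V) (g : κ[X]) (l : V →ₗ[Fq] κ) (x : V) :
    aeval (precomp κ u) g l x
      = ∑ j ∈ Finset.range (g.natDegree + 1), g.coeff j * l ((u ^ j) x) := by
  simp only [aeval_eq_sum_range, LinearMap.sum_apply, LinearMap.smul_apply, precomp_pow_apply,
    smul_eq_mul]

theorem aeval_precomp_map_apply (u : V →ₗ[Fq] V) (a : Fq[X]) (l : V →ₗ[Fq] κ) (x : V) :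
    aeval (precomp κ u) (a.map (algebraMap Fq κ)) l x = l (aeval u a x) := by
  rw [aeval_precomp_apply, natDegree_map, aeval_eq_sum_range, LinearMap.sum_apply, map_sum]
  refine Finset.sum_congr rfl fun j _ => ?_
  rw [coeff_map, LinearMap.smul_apply, map_smul, Algebra.smul_def]

/-- The sequence `e ↦ l (T ^ e x)`. -/
def orbit (T : V →ₗ[Fq] V) (x : V) : (V →ₗ[Fq] κ) →ₗ[κ] (ℕ → κ) where
  toFun l e := l ((T ^ e) x)
  map_add' _ _ := rfl
  map_smul' _ _ := rfl

variable (T : V →ₗ[Fq] V) (H : Fq[X])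

/-- The pairing of a linear form and a point killed by `H(T)`, with values in `κ[X] / H`, as a linear
map in the linear form. -/
def pairing (x : V) : (V →ₗ[Fq] κ) →ₗ[κ] κ[X] ⧸ Ideal.span {H.map (algebraMap Fq κ)} :=
  (Ideal.Quotient.mkₐ κ _).toLinearMap ∘ₗ divDiff (H.map (algebraMap Fq κ)) ∘ₗ orbit T x

theorem pairing_apply (x : V) (l : V →ₗ[Fq] κ) :
    pairing T H x l = Ideal.Quotient.mk _ (divDiff (H.map (algebraMap Fq κ)) (orbit T x l)) := rfl

theorem pairing_sum {ι : Type*} (s : Finset ι) (x : ι → V) (l : V →ₗ[Fq] κ) :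
    pairing T H (∑ i ∈ s, x i) l = ∑ i ∈ s, pairing T H (x i) l := by
  have : orbit T (∑ i ∈ s, x i) l = ∑ i ∈ s, orbit T (x i) l := by
    ext e
    simp [orbit]
  simp only [pairing_apply, this, map_sum]

theorem pairing_precomp {u : V →ₗ[Fq] V} (hu : Commute u T) (x : V) (l : V →ₗ[Fq] κ) :
    pairing T H x (precomp κ u l) = pairing T H (u x) l := by
  have : orbit T x (precomp κ u l) = orbit T (u x) l := by
    ext e
    exact congrArg l (LinearMap.congr_fun (hu.pow_right e).eq x)
  rw [pairing_apply, this, pairing_apply]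

/-- Of the two error terms in `divDiff_shift`, one is a multiple of H, and the other is the value of
l at H(T)x = 0. -/
theorem pairing_precomp_self {x : V} (hx : aeval T H x = 0) (l : V →ₗ[Fq] κ) :
    pairing T H x (precomp κ T l) = (X : κ[X]) • pairing T H x l := by
  have h1 : orbit T x (precomp κ T l) = fun e => orbit T x l (e + 1) := by
    ext e
    change l (T ((T ^ e) x)) = l ((T ^ (e + 1)) x)
    rw [pow_succ', Module.End.mul_apply]
  have h2 : ∑ j ∈ Finset.range ((H.map (algebraMap Fq κ)).natDegree + 1),
      (H.map (algebraMap Fq κ)).coeff j * orbit T x l j = 0 := by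
    have := aeval_precomp_map_apply T H l x
    rw [hx, map_zero, aeval_precomp_apply] at this
    exact this
  rw [pairing_apply, pairing_apply, h1, divDiff_shift, h2, map_zero, add_zero, map_sub,
    Ideal.Quotient.eq_zero_iff_mem.2 (Ideal.mul_mem_left _ _ (Ideal.mem_span_singleton_self _)),
    sub_zero, map_mul]
  rfl

/-- The pairing with a point killed by `H(T)` as a `κ[X]`-linear map, `X` acting on linear forms by
composition with `T`. -/
def pairingHom {x : V} (hx : aeval T H x = 0) :
    Module.AEval' (precomp κ T) →ₗ[κ[X]] κ[X] ⧸ Ideal.span {H.map (algebraMap Fq κ)} :=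
  LinearMap.ofAEval _ (pairing T H x) (pairing_precomp_self T H hx)

theorem pairingHom_of {x : V} (hx : aeval T H x = 0) (l : V →ₗ[Fq] κ) :
    pairingHom T H hx (Module.AEval'.of _ l) = pairing T H x l := rfl

theorem pairing_aeval {x : V} (hx : aeval T H x = 0) (a : Fq[X]) (l : V →ₗ[Fq] κ) :
    pairing T H (aeval T a x) l = a.map (algebraMap Fq κ) • pairing T H x l := by
  have h := map_smul (pairingHom T H hx) (a.map (algebraMap Fq κ)) (Module.AEval'.of _ l)
  rw [pairingHom_of, ← Module.AEval.of_aeval_smul] at h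
  have hcomm : Commute (aeval T a) T := by
    simpa only [aeval_X] using (Commute.all a X).map (aeval T)
  have hl : precomp κ (aeval T a) l = aeval (precomp κ T) (a.map (algebraMap Fq κ)) l := by
    ext y
    exact (aeval_precomp_map_apply T a l y).symm
  rw [← h, ← pairing_precomp T H hcomm x l, hl]
  rfl

theorem apply_eq_zero_of_pairing_eq_zero (hH : 0 < H.natDegree) {x : V} {l : V →ₗ[Fq] κ}
    (h : pairing T H x l = 0) : l x = 0 := by
  rw [pairing_apply, Ideal.Quotient.eq_zero_iff_mem, Ideal.mem_span_singleton] at h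
  exact eq_zero_of_dvd_divDiff (by rwa [natDegree_map]) _ h

end Pairing

end TorsionPairing

/-! ### Comparison of the characteristic polynomials of the Frobenius -/

namespace TorsionPairing

variable {Fq κ : Type*} [Field Fq] [Fintype Fq] [Field κ] [Algebra Fq κ]

/-- The map `x ↦ x ^ (q ^ i)` as a linear form. -/
def frobForm (Fq κ : Type*) [Field Fq] [Fintype Fq] [Field κ] [Algebra Fq κ] (i : ℕ) :
    κ →ₗ[Fq] κ :=
  (FiniteField.frobeniusAlgHom Fq κ ^ i).toLinearMap

theorem frobForm_apply (i : ℕ) (x : κ) : frobForm Fq κ i x = x ^ Fintype.card Fq ^ i := by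
  change (FiniteField.frobeniusAlgHom Fq κ ^ i) x = _
  rw [AlgHom.coe_pow, FiniteField.coe_frobeniusAlgHom, pow_iterate]

theorem frobForm_mul (i : ℕ) (x y : κ) :
    frobForm Fq κ i (x * y) = frobForm Fq κ i x * frobForm Fq κ i y := by
  simp only [frobForm_apply, mul_pow]

theorem frobForm_frobForm (i j : ℕ) (x : κ) :
    frobForm Fq κ i (frobForm Fq κ j x) = frobForm Fq κ (i + j) x := by
  rw [frobForm_apply, frobForm_apply, frobForm_apply, ← pow_mul, ← pow_add, add_comm]

variable (T : κ →ₗ[Fq] κ) (c : ℕ → κ) (s : ℕ)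

/-- The polynomial `∑ cⱼ X ^ (q ^ j)`. -/
def additivePoly (q : ℕ) (c : ℕ → κ) (s : ℕ) : κ[X] :=
  ∑ j ∈ Finset.range (s + 1), C (c j) * X ^ q ^ j

theorem natDegree_additivePoly {q : ℕ} (hq : 1 < q) (hc : c s ≠ 0) :
    (additivePoly q c s).natDegree = q ^ s := by
  rw [additivePoly, AdditiveAction.natDegree_sum_of_strictMono _ _ _ _ hc, natDegree_X_pow]
  intro i j hij
  simpa using Nat.pow_lt_pow_right hq hij

theorem derivative_additivePoly :
    derivative (additivePoly (Fintype.card Fq) c s) = C (c 0) := by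
  have hq : ((Fintype.card Fq : ℕ) : κ) = 0 := by
    rw [← map_natCast (algebraMap Fq κ), Nat.cast_card_eq_zero, map_zero]
  rw [additivePoly, derivative_sum, Finset.sum_range_succ', Finset.sum_eq_zero]
  · simp
  · intro j _
    simp [derivative_X_pow, hq]

variable {T c s}

theorem eval_additivePoly (hT : ∀ x, T x = ∑ j ∈ Finset.range (s + 1), c j * frobForm Fq κ j x)
    (x : κ) : (additivePoly (Fintype.card Fq) c s).eval x = T x := by
  simp [additivePoly, hT, eval_finsetSum, frobForm_apply]

theorem X_smul_frobForm (hT : ∀ x, T x = ∑ j ∈ Finset.range (s + 1), c j * frobForm Fq κ j x)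
    (i : ℕ) :
    (X : κ[X]) • Module.AEval'.of (precomp κ T) (frobForm Fq κ i)
      = ∑ j ∈ Finset.range (s + 1), C (frobForm Fq κ i (c j)) •
        Module.AEval'.of (precomp κ T) (frobForm Fq κ (i + j)) := by
  have : precomp κ T (frobForm Fq κ i)
      = ∑ j ∈ Finset.range (s + 1), frobForm Fq κ i (c j) • frobForm Fq κ (i + j) := by
    ext x
    change frobForm Fq κ i (T x) = _
    simp only [hT, map_sum, LinearMap.sum_apply, LinearMap.smul_apply, frobForm_mul,
      frobForm_frobForm, smul_eq_mul]
  rw [Module.AEval'.X_smul_of, this, map_sum]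
  simp only [map_smul, Module.AEval.C_smul]

/-- The matrix of the Frobenius on the module of twisted polynomials. -/
def motiveMatrix (Fq : Type*) {κ : Type*} [Field Fq] [Fintype Fq] [Field κ] [Algebra Fq κ]
    (c : ℕ → κ) (d s : ℕ) : Matrix (Fin s) (Fin s) κ[X] :=
  TwistedElimination.frobMatrix (fun i j => frobForm Fq κ i (c j)) d s

theorem frobForm_add_eq_sum (hT : ∀ x, T x = ∑ j ∈ Finset.range (s + 1), c j * frobForm Fq κ j x)
    (hs : 0 < s) (hc : c s ≠ 0) (d : ℕ) (i : Fin s) :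
    Module.AEval'.of (precomp κ T) (frobForm Fq κ (d + i))
      = ∑ j : Fin s, motiveMatrix Fq c d s i j •
        Module.AEval'.of (precomp κ T) (frobForm Fq κ j) := by
  refine TwistedElimination.frobMatrix_spec (fun i j => frobForm Fq κ i (c j)) d s hs (fun i => ?_)
    (fun i => Module.AEval'.of (precomp κ T) (frobForm Fq κ i)) (X_smul_frobForm hT) i
  rw [frobForm_apply]
  exact pow_ne_zero _ hc

/-- The matrix of the pairing. -/
def pairingMatrix (T : κ →ₗ[Fq] κ) (H : Fq[X]) (x : Fin s → κ) : Matrix (Fin s) (Fin s) κ[X] :=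
  Matrix.of fun i l => divDiff (H.map (algebraMap Fq κ)) (orbit T (x l) (frobForm Fq κ i))

/-- The pairing of τ^(d+i) with x l is computed twice: expanding the form in 1, …, τ^(s-1), and
moving τ^d across to the point. -/
theorem motiveMatrix_mul_pairingMatrix {H : Fq[X]}
    (hT : ∀ x, T x = ∑ j ∈ Finset.range (s + 1), c j * frobForm Fq κ j x)
    (hs : 0 < s) (hc : c s ≠ 0) {d : ℕ} (hcomm : Commute (frobForm Fq κ d) T)
    {x : Fin s → κ} (hx : ∀ l, aeval T H (x l) = 0) (Φ : Matrix (Fin s) (Fin s) Fq[X])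
    (hΦ : ∀ l, frobForm Fq κ d (x l) = ∑ k, aeval T (Φ k l) (x k)) :
    (motiveMatrix Fq c d s * pairingMatrix T H x).map
        (Ideal.Quotient.mk (Ideal.span {H.map (algebraMap Fq κ)}))
      = (pairingMatrix T H x * Φ.map (mapRingHom (algebraMap Fq κ))).map
        (Ideal.Quotient.mk (Ideal.span {H.map (algebraMap Fq κ)})) := by
  ext1 i l
  have h1 := congrArg (pairingHom T H (hx l)) (frobForm_add_eq_sum hT hs hc d i)
  have h2 : frobForm Fq κ (d + i) = precomp κ (frobForm Fq κ d) (frobForm Fq κ i) := by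
    ext y
    change _ = frobForm Fq κ i (frobForm Fq κ d y)
    rw [frobForm_frobForm, add_comm]
  rw [pairingHom_of, h2, pairing_precomp T H hcomm, hΦ, pairing_sum, map_sum] at h1
  simp only [map_smul, pairingHom_of, pairing_aeval T H (hx _)] at h1
  rw [Matrix.map_apply, Matrix.map_apply, Matrix.mul_apply, Matrix.mul_apply, map_sum, map_sum]
  refine Eq.trans (Finset.sum_congr rfl fun j _ => ?_) (h1.symm.trans
    (Finset.sum_congr rfl fun j _ => ?_))
  · rw [map_mul]
    rfl
  · rw [map_mul, mul_comm]
    rfl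

section

variable [IsAlgClosed κ] {H : Fq[X]}

/-- The form obtained by letting g act on ∑ v i τ^i pairs to zero with generators of the H-torsion,
hence with all of it. Nondegeneracy makes it vanish at every torsion point, which its degree as a
polynomial forbids unless v = 0. -/
theorem eq_zero_of_vecMul_eq_zero
    (hT : ∀ x, T x = ∑ j ∈ Finset.range (s + 1), c j * frobForm Fq κ j x)
    (hs : 0 < s) (hc : c s ≠ 0) (hH : 0 < H.natDegree) (hH0 : aeval (c 0) H ≠ 0)
    {x : Fin s → κ} (hx : ∀ l, aeval T H (x l) = 0)
    (hgen : ∀ y, aeval T H y = 0 → ∃ a : Fin s → Fq[X], y = ∑ l, aeval T (a l) (x l))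
    {g : κ[X]} (hg : g ≠ 0) (hgH : g.natDegree < H.natDegree) (v : Fin s → κ)
    (hv : ∀ l, g • ∑ i : Fin s, v i • pairing T H (x l) (frobForm Fq κ i) = 0) : v = 0 := by
  have hq : 1 < Fintype.card Fq := Fintype.one_lt_card
  refine AdditiveAction.eq_zero_of_forall_ker (additivePoly (Fintype.card Fq) c s) T
    (eval_additivePoly hT) hq hs (natDegree_additivePoly c s hq hc) (derivative_additivePoly c s)
    hH0 hg hgH v fun y hy => ?_
  let m : κ →ₗ[Fq] κ := aeval (precomp κ T) g (∑ i : Fin s, v i • frobForm Fq κ i)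
  have hm : ∀ l, pairing T H (x l) m = 0 := by
    intro l
    have h := map_smul (pairingHom T H (hx l)) g
      (Module.AEval'.of _ (∑ i : Fin s, v i • frobForm Fq κ i))
    rw [pairingHom_of, ← Module.AEval.of_aeval_smul, map_sum] at h
    simp only [map_smul] at h
    rw [hv] at h
    exact h
  obtain ⟨a, rfl⟩ := hgen y hy
  have hmy : m (∑ l, aeval T (a l) (x l)) = 0 := by
    apply apply_eq_zero_of_pairing_eq_zero T H hH
    rw [pairing_sum]
    exact Finset.sum_eq_zero fun l _ => by rw [pairing_aeval T H (hx l), hm, smul_zero]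
  rw [← hmy, aeval_precomp_apply]
  simp only [LinearMap.sum_apply, LinearMap.smul_apply, smul_eq_mul, Finset.mul_sum,
    frobForm_apply]
  rw [Finset.sum_comm]
  exact Finset.sum_congr rfl fun _ _ => Finset.sum_congr rfl fun _ _ => by ring

/-- At a common root a of the determinant and H = (X - a)g, a left kernel vector v of the evaluated
matrix makes the pairings of ∑ v i τ^i divisible by X - a. Multiplying by g kills them modulo H,
which contradicts the preceding count. -/
theorem isCoprime_det_pairingMatrix
    (hT : ∀ x, T x = ∑ j ∈ Finset.range (s + 1), c j * frobForm Fq κ j x)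
    (hs : 0 < s) (hc : c s ≠ 0) (hH : 0 < H.natDegree) (hH0 : aeval (c 0) H ≠ 0)
    {x : Fin s → κ} (hx : ∀ l, aeval T H (x l) = 0)
    (hgen : ∀ y, aeval T H y = 0 → ∃ a : Fin s → Fq[X], y = ∑ l, aeval T (a l) (x l)) :
    IsCoprime (pairingMatrix T H x).det (H.map (algebraMap Fq κ)) := by
  have hH' : H.map (algebraMap Fq κ) ≠ 0 := map_ne_zero fun h => by simp [h] at hH
  rw [isCoprime_comm]
  refine isCoprime_of_irreducible_dvd (fun h => hH' h.1) fun p hp hpH hpW => ?_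
  obtain ⟨a, ha⟩ := IsAlgClosed.exists_root p (degree_pos_of_irreducible hp).ne'
  have haH : (H.map (algebraMap Fq κ)).IsRoot a := ha.dvd hpH
  have haW : (pairingMatrix T H x).det.eval a = 0 := ha.dvd hpW
  obtain ⟨g, hg⟩ := dvd_iff_isRoot.2 haH
  have hg0 : g ≠ 0 := by
    rintro rfl
    exact hH' (by rw [hg, mul_zero])
  have hgH : g.natDegree < H.natDegree := by
    have := congrArg natDegree hg
    rw [natDegree_map, natDegree_mul (X_sub_C_ne_zero a) hg0, natDegree_X_sub_C] at this
    omega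
  rw [← coe_evalRingHom, RingHom.map_det, ← Matrix.exists_vecMul_eq_zero_iff] at haW
  obtain ⟨v, hv0, hv⟩ := haW
  refine hv0 (eq_zero_of_vecMul_eq_zero hT hs hc hH hH0 hx hgen hg0 hgH v fun l => ?_)
  have h1 : (X - C a) ∣ ∑ i : Fin s, C (v i) * pairingMatrix T H x i l := by
    rw [dvd_iff_isRoot, IsRoot.def, eval_finsetSum]
    simpa [Matrix.vecMul, dotProduct] using congrFun hv l
  have h2 : g • ∑ i : Fin s, v i • pairing T H (x l) (frobForm Fq κ i)
      = Ideal.Quotient.mk _ (g * ∑ i : Fin s, C (v i) * pairingMatrix T H x i l) := by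
    rw [map_mul, map_sum]
    refine congrArg (fun z => g • z) (Finset.sum_congr rfl fun i _ => ?_)
    rw [← smul_eq_C_mul]
    exact (map_smul (Ideal.Quotient.mkₐ κ (Ideal.span {H.map (algebraMap Fq κ)})) (v i) _).symm
  rw [h2, Ideal.Quotient.eq_zero_iff_mem, Ideal.mem_span_singleton, hg, mul_comm]
  exact mul_dvd_mul_left _ h1

theorem _root_.Matrix.charpoly_eq_of_mul_eq_mul {R ι : Type*} [CommRing R] [Fintype ι]
    [DecidableEq ι] {A B W : Matrix ι ι R} (hW : IsUnit W.det) (h : A * W = W * B) :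
    A.charpoly = B.charpoly := by
  obtain ⟨U, rfl⟩ := (Matrix.isUnit_iff_isUnit_det W).2 hW
  rw [← Matrix.charpoly_units_conj U B, ← h, Matrix.mul_assoc]
  simp

/-- The characteristic polynomials of the Frobenius on the `H`-torsion and on the module of twisted
polynomials agree modulo `H`. -/
theorem charpoly_motiveMatrix_map_mk
    (hT : ∀ x, T x = ∑ j ∈ Finset.range (s + 1), c j * frobForm Fq κ j x)
    (hs : 0 < s) (hc : c s ≠ 0) {d : ℕ} (hcomm : Commute (frobForm Fq κ d) T)
    (hH : 0 < H.natDegree) (hH0 : aeval (c 0) H ≠ 0)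
    {x : Fin s → κ} (hx : ∀ l, aeval T H (x l) = 0)
    (hgen : ∀ y, aeval T H y = 0 → ∃ a : Fin s → Fq[X], y = ∑ l, aeval T (a l) (x l))
    (Φ : Matrix (Fin s) (Fin s) Fq[X])
    (hΦ : ∀ l, frobForm Fq κ d (x l) = ∑ k, aeval T (Φ k l) (x k)) :
    (motiveMatrix Fq c d s).charpoly.map (Ideal.Quotient.mk (Ideal.span {H.map (algebraMap Fq κ)}))
      = (Φ.charpoly.map (mapRingHom (algebraMap Fq κ))).map
        (Ideal.Quotient.mk (Ideal.span {H.map (algebraMap Fq κ)})) := by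
  set π := Ideal.Quotient.mk (Ideal.span {H.map (algebraMap Fq κ)})
  rw [← Matrix.charpoly_map, ← Matrix.charpoly_map, ← Matrix.charpoly_map]
  refine Matrix.charpoly_eq_of_mul_eq_mul (W := (pairingMatrix T H x).map π) ?_ ?_
  · have h := (isCoprime_det_pairingMatrix hT hs hc hH hH0 hx hgen).map π
    have h0 : π (H.map (algebraMap Fq κ)) = 0 :=
      Ideal.Quotient.eq_zero_iff_mem.2 (Ideal.mem_span_singleton_self _)
    rw [h0, isCoprime_zero_right, RingHom.map_det] at h
    exact h
  · rw [← Matrix.map_mul, ← Matrix.map_mul]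
    exact motiveMatrix_mul_pairingMatrix hT hs hc hcomm hx Φ hΦ

end

end TorsionPairing

/-! ### Torsion bases -/

theorem card_adjoinRoot {Fq : Type*} [Field Fq] [Fintype Fq] {h : Fq[X]} (hh : h ≠ 0) :
    Nat.card (AdjoinRoot h) = Fintype.card Fq ^ h.natDegree := by
  have : Module.Finite Fq (AdjoinRoot h) := (AdjoinRoot.powerBasis hh).finite
  have : Finite (AdjoinRoot h) := Module.finite_of_finite Fq
  have : Fintype (AdjoinRoot h) := Fintype.ofFinite _
  rw [Nat.card_eq_fintype_card, Module.card_eq_pow_finrank (K := Fq),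
    (AdjoinRoot.powerBasis hh).finrank, AdjoinRoot.powerBasis_dim]

/-- A module over `F_q[X]` with `h`-torsion of cardinality `q ^ (s * deg h)`, for `h` irreducible, has
`h`-torsion free of rank `s` over `F_q[X] / h`. -/
theorem exists_torsion_basis {Fq M : Type*} [Field Fq] [Fintype Fq] [AddCommGroup M]
    [Module Fq[X] M] {h : Fq[X]} (hh : Irreducible h) {s : ℕ} (S : Finset M)
    (hS : ∀ x, x ∈ S ↔ h • x = 0) (hcard : S.card = Fintype.card Fq ^ (s * h.natDegree)) :
    ∃ e : Fin s → M, (∀ i, h • e i = 0) ∧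
      (∀ a : Fin s → Fq[X], ∑ i, a i • e i = 0 → ∀ i, h ∣ a i) ∧
      ∀ y, h • y = 0 → ∃ a : Fin s → Fq[X], y = ∑ i, a i • e i := by
  let N := Submodule.torsionBy Fq[X] M h
  have : (Ideal.span {h}).IsMaximal := PrincipalIdealRing.isMaximal_of_irreducible hh
  let _ : Field (Fq[X] ⧸ Ideal.span {h}) := Ideal.Quotient.field _
  have hNS : ∀ x, x ∈ N ↔ x ∈ S := fun x => (Submodule.mem_torsionBy_iff h x).trans (hS x).symm
  let E : N ≃ S := Equiv.subtypeEquivRight hNS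
  have hcardN : Nat.card N = S.card := by
    rw [Nat.card_congr E, Nat.card_eq_fintype_card, Fintype.card_coe]
  have : Finite N := Finite.of_equiv S E.symm
  have : Module.Finite (Fq[X] ⧸ Ideal.span {h}) N := Module.Finite.of_finite
  have hK : Nat.card (Fq[X] ⧸ Ideal.span {h}) = Fintype.card Fq ^ h.natDegree :=
    card_adjoinRoot hh.ne_zero
  have hrank : Module.finrank (Fq[X] ⧸ Ideal.span {h}) N = s := by
    have h1 := Module.natCard_eq_pow_finrank (K := Fq[X] ⧸ Ideal.span {h}) (V := N)
    rw [hcardN, hcard, hK, ← pow_mul, mul_comm] at h1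
    exact (Nat.eq_of_mul_eq_mul_left hh.natDegree_pos
      (Nat.pow_right_injective (Fintype.one_lt_card) h1)).symm
  let b := Module.finBasisOfFinrankEq _ _ hrank
  have hsum : ∀ a : Fin s → Fq[X], ((∑ i, Ideal.Quotient.mk (Ideal.span {h}) (a i) • b i : N) : M)
      = ∑ i, a i • (b i : M) := fun a => by
    rw [Submodule.coe_sum]
    rfl
  refine ⟨fun i => b i, fun i => (Submodule.mem_torsionBy_iff h _).1 (b i).2, fun a ha i => ?_,
    fun y hy => ?_⟩
  · have h1 : ∑ i, Ideal.Quotient.mk (Ideal.span {h}) (a i) • b i = 0 :=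
      Subtype.ext ((hsum a).trans ha)
    have h2 := Fintype.linearIndependent_iff.1 b.linearIndependent _ h1 i
    rwa [Ideal.Quotient.eq_zero_iff_mem, Ideal.mem_span_singleton] at h2
  · choose a ha using fun i => Ideal.Quotient.mk_surjective
      (b.repr ⟨y, (Submodule.mem_torsionBy_iff h y).2 hy⟩ i)
    refine ⟨a, ?_⟩
    rw [← hsum]
    simp only [ha, b.sum_repr]

/-! ### The reduction of a Drinfeld module -/

theorem TwistedPoly.act_apply_eq_sum {q : ℕ} {K B : Type*} [Field K] [CommRing B] [Algebra K B]
    (ι : K[X] →ₐ[K] B) (σ : B →ₐ[K] B) (P : TwistedPoly q K) (N : ℕ)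
    (hN : ∀ i, N < i → ι (P.coeff i) = 0) (b : B) :
    P.act ι σ b = ∑ i ∈ Finset.range (N + 1), ι (P.coeff i) * (σ ^ i) b := by
  have h1 : P.act ι σ b = ∑ i ∈ P.support, ι (P.coeff i) * (σ ^ i) b := by
    simp [TwistedPoly.act, LinearMap.sum_apply]
  have h2 : ∀ i, i ∉ P.support → P.coeff i = 0 := fun i hi => SkewPolynomial.notMem_support_iff.1 hi
  rw [h1, Finset.sum_subset (Finset.subset_union_left (s₂ := Finset.range (N + 1)))]
  · refine (Finset.sum_subset Finset.subset_union_right fun i _ hi => ?_).symm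
    rw [hN i (by simpa [Nat.lt_succ_iff] using hi), zero_mul]
  · intro i _ hi
    rw [h2 i hi, map_zero, zero_mul]

theorem exists_algebraMap_eq_of_pow_card_eq {Fq κ : Type*} [Field Fq] [Fintype Fq] [Field κ]
    [Algebra Fq κ] {x : κ} (hx : x ^ Fintype.card Fq = x) : ∃ a : Fq, algebraMap Fq κ a = x := by
  classical
  by_contra! h
  have hq : 1 < Fintype.card Fq := Fintype.one_lt_card
  let S := insert x (Finset.univ.map ⟨algebraMap Fq κ, (algebraMap Fq κ).injective⟩)
  have hS : S.card = Fintype.card Fq + 1 := by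
    rw [Finset.card_insert_of_notMem (by simpa using h), Finset.card_map, Finset.card_univ]
  refine FiniteField.X_pow_card_sub_X_ne_zero κ hq
    (eq_zero_of_natDegree_lt_card_of_eval_eq_zero' _ S (fun y hy => ?_) ?_)
  · rw [eval_sub, eval_pow, eval_X, sub_eq_zero]
    rcases Finset.mem_insert.1 hy with rfl | hy
    · exact hx
    · obtain ⟨a, _, rfl⟩ := Finset.mem_map.1 hy
      change algebraMap Fq κ a ^ _ = algebraMap Fq κ a
      rw [← map_pow, FiniteField.pow_card]
  · rw [FiniteField.X_pow_card_sub_X_natDegree_eq κ hq, hS]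
    exact Nat.lt_succ_self _

/-- Raising coefficients to the q-th power fixes both b and h, so it changes a only by a multiple of
h^n for every n, hence not at all. Fixed coefficients lie in F_q. -/
theorem exists_map_eq_of_forall_dvd_sub {Fq κ : Type*} [Field Fq] [Fintype Fq] [Field κ]
    [Algebra Fq κ] {h : Fq[X]} (hh : 0 < h.natDegree) (a : κ[X])
    (ha : ∀ n, ∃ b : Fq[X], (h ^ n).map (algebraMap Fq κ) ∣ a - b.map (algebraMap Fq κ)) :
    ∃ b : Fq[X], b.map (algebraMap Fq κ) = a := by
  let σ : κ →+* κ := (FiniteField.frobeniusAlgHom Fq κ : κ →ₐ[Fq] κ)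
  have hσ : ∀ b : Fq[X], (b.map (algebraMap Fq κ)).map σ = b.map (algebraMap Fq κ) := fun b => by
    rw [Polynomial.map_map]
    congr 1
    exact AlgHom.comp_algebraMap _
  have hfix : a.map σ - a = 0 := by
    obtain ⟨b, hb⟩ := ha ((a.map σ - a).natDegree + 1)
    have hb' := Polynomial.map_dvd σ hb
    rw [Polynomial.map_sub, hσ, hσ] at hb'
    have h1 := dvd_sub hb' hb
    rw [sub_sub_sub_cancel_right] at h1
    by_contra hne
    have h2 := natDegree_le_of_dvd h1 hne
    rw [natDegree_map, natDegree_pow] at h2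
    nlinarith
  have hc : ∀ n, a.coeff n ∈ Set.range (algebraMap Fq κ) := fun n => by
    have := congrArg (coeff · n) (sub_eq_zero.1 hfix)
    simp only [coeff_map] at this
    exact exists_algebraMap_eq_of_pow_card_eq this
  exact (mem_lifts a).1 ((lifts_iff_coeff_lifts a).2 hc)

theorem toResidueClosure_eq_zero_iff {Fq : Type*} [Field Fq] (f : Fq[X]) [Fact (Irreducible f)]
    (a : Fq[X]) : toResidueClosure f a = 0 ↔ f ∣ a := by
  change algebraMap (AdjoinRoot f) (ResidueClosure f) (AdjoinRoot.mk f a) = 0 ↔ _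
  rw [map_eq_zero, AdjoinRoot.mk_eq_zero]

theorem aeval_toResidueClosure_X {Fq : Type*} [Field Fq] (f : Fq[X]) [Fact (Irreducible f)]
    (a : Fq[X]) :
    aeval (toResidueClosure f X) a = toResidueClosure f a := by
  rw [aeval_algHom_apply, aeval_X_left_apply]

namespace DrinfeldModule

variable {Fq : Type*} [Field Fq] [Fintype Fq] {r : ℕ} (φ : DrinfeldModule Fq r) (f : Fq[X])
  [Fact (Irreducible f)]

/-- The coefficients of the reduction of `φ_θ`. -/
def redCoeff (j : ℕ) : ResidueClosure f := toResidueClosure f (φ.coeff j)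

theorem redCoeff_zero : φ.redCoeff f 0 = toResidueClosure f X :=
  congrArg _ φ.coeff_zero

variable {f} {s : ℕ}

theorem redCoeff_ne_zero (hs : φ.IsReductionDegree f s) : φ.redCoeff f s ≠ 0 := fun h =>
  hs.1 ((toResidueClosure_eq_zero_iff f _).1 h)

theorem reductionAct_apply (hs : φ.IsReductionDegree f s) (x : ResidueClosure f) :
    φ.reductionAct f x
      = ∑ j ∈ Finset.range (s + 1), φ.redCoeff f j * TorsionPairing.frobForm Fq _ j x :=
  TwistedPoly.act_apply_eq_sum _ _ _ s
    (fun i hi => (toResidueClosure_eq_zero_iff f _).2 (hs.2 i hi)) x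

theorem commute_frobForm_reductionAct :
    Commute (TorsionPairing.frobForm Fq (ResidueClosure f) f.natDegree) (φ.reductionAct f) :=
  LinearMap.ext fun x => φ.frobenius_comm f x

/-- The characteristic polynomial of the Frobenius on the module of twisted polynomials. -/
def motiveCharpoly (f : Fq[X]) [Fact (Irreducible f)] (s : ℕ) : (ResidueClosure f)[X][X] :=
  (TorsionPairing.motiveMatrix Fq (φ.redCoeff f) f.natDegree s).charpoly

/-- Since h ≠ f, every h^n is nonzero at θ modulo f. Torsion is therefore étale, and a basis of the
h-torsion lifts along divisibility. One basis serves all levels n, so the congruences concern a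
single Frobenius matrix over the completion. -/
theorem exists_tate_basis (hf : f.Monic) (hs : φ.IsReductionDegree f s) (hs0 : 0 < s) {h : Fq[X]}
    (hh : h.Monic) (hirr : Irreducible h) (hne : h ≠ f) :
    ∃ b : Module.Basis (Fin s) (HCompletion h) (TateModule h (φ.ReductionPoints f)), ∀ n,
      ∀ k, (h ^ n).map (algebraMap Fq (ResidueClosure f)) ∣ (φ.motiveCharpoly f s).coeff k
        - ((Matrix.of fun i j => TateModule.rep (LinearMap.toMatrix b b
            (TateModule.map (φ.frobenius f)) i j) n).charpoly.coeff k).map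
              (algebraMap Fq (ResidueClosure f)) := by
  have hfi : Irreducible f := Fact.out
  set T := φ.reductionAct f
  have hT := φ.reductionAct_apply hs
  have hc := φ.redCoeff_ne_zero hs
  have hq : 1 < Fintype.card Fq := Fintype.one_lt_card
  have hfh : ∀ n, ¬ f ∣ h ^ n := fun n hn => by
    have h1 := hfi.prime.dvd_of_dvd_pow hn
    exact hne (eq_of_monic_of_associated hf hh (hfi.associated_of_dvd hirr h1)).symm
  have hH0 : ∀ n, aeval (φ.redCoeff f 0) (h ^ n) ≠ 0 := fun n => by
    rw [redCoeff_zero, aeval_toResidueClosure_X, Ne, toResidueClosure_eq_zero_iff]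
    exact hfh n
  have hpdeg := TorsionPairing.natDegree_additivePoly (φ.redCoeff f) s hq hc
  have hp1 : 1 < (TorsionPairing.additivePoly (Fintype.card Fq) (φ.redCoeff f) s).natDegree :=
    hpdeg ▸ Nat.one_lt_pow hs0.ne' hq
  have hpT := TorsionPairing.eval_additivePoly hT
  obtain ⟨S, hS, hcard⟩ := AdditiveAction.exists_finset_ker _ T hpT hp1
    (TorsionPairing.derivative_additivePoly (φ.redCoeff f) s) (H := h) (by simpa using hH0 1)
  rw [hpdeg, ← pow_mul] at hcard
  obtain ⟨e, he, hind, hspan⟩ := exists_torsion_basis hirr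
    (S.map (Module.AEval'.of T).toEquiv.toEmbedding) (fun x => by
      rw [Finset.mem_map_equiv]
      exact hS _) ((Finset.card_map _).trans hcard)
  have hdiv : ∀ y : φ.ReductionPoints f, ∃ x, h • x = y := fun y =>
    AdditiveAction.exists_aeval_apply_eq _ T hpT hp1 hh.ne_zero y
  choose x hx using fun i => TateModule.exists_lift hdiv (he i)
  simp only [← hx] at hind hspan
  obtain ⟨b, hb⟩ := TateModule.exists_basis x hind hspan
  refine ⟨b, fun n k => ?_⟩
  -- At level 0 the modulus is 1; the pairing needs a modulus of positive degree.
  rcases Nat.eq_zero_or_pos n with rfl | hn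
  · simp
  have hdeg : 0 < (h ^ n).natDegree := by
    rw [natDegree_pow]
    exact Nat.mul_pos hn hirr.natDegree_pos
  have key := TorsionPairing.charpoly_motiveMatrix_map_mk hT hs0 hc
    φ.commute_frobForm_reductionAct hdeg (hH0 n)
    (x := fun l => (Module.AEval'.of T).symm ((b l).1 n)) (fun l => (b l).2.1 n) (fun y hy => by
      obtain ⟨a, ha⟩ := TateModule.exists_eq_sum_smul x hspan n (Module.AEval'.of T y) hy
      simp only [← hb] at ha
      exact ⟨a, ha⟩)
    (Matrix.of fun i j => TateModule.rep (LinearMap.toMatrix b b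
            (TateModule.map (φ.frobenius f)) i j) n) (fun l => by
      exact TateModule.map_apply_eq_sum b (φ.frobenius f) n l)
  have key' := congrArg (Polynomial.coeff · k) key
  simp only [coeff_map] at key'
  rw [Ideal.Quotient.mk_eq_mk_iff_sub_mem, Ideal.mem_span_singleton] at key'
  exact key'

/-- The polynomial on κ{τ} does not involve h. One auxiliary prime h₀ ≠ f suffices to descend its
coefficients to A, and the congruences modulo h^n then identify it for every other h. -/
theorem exists_frobenius_charpoly (hf : f.Monic) (hs : φ.IsReductionDegree f s) (hs0 : 0 < s) :
    ∃ P : Fq[X][X], P.map (mapRingHom (algebraMap Fq (ResidueClosure f))) = φ.motiveCharpoly f s ∧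
      ∀ h : Fq[X], h.Monic → Irreducible h → h ≠ f → φ.IsFrobeniusCharpoly f s h P := by
  obtain ⟨h₀, hm₀, hi₀, hne₀⟩ : ∃ h : Fq[X], h.Monic ∧ Irreducible h ∧ h ≠ f := by
    by_cases h : X = f
    · refine ⟨X - C 1, monic_X_sub_C 1, irreducible_X_sub_C 1, fun h' => ?_⟩
      rw [← h] at h'
      simpa using congrArg (eval 0) h'
    · exact ⟨X, monic_X, irreducible_X, h⟩
  have hlift : ∀ k, (φ.motiveCharpoly f s).coeff k
      ∈ Set.range (mapRingHom (algebraMap Fq (ResidueClosure f))) := fun k => by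
    obtain ⟨b, hb⟩ := φ.exists_tate_basis hf hs hs0 hm₀ hi₀ hne₀
    exact exists_map_eq_of_forall_dvd_sub hi₀.natDegree_pos _ fun n => ⟨_, hb n k⟩
  obtain ⟨P, hP⟩ := (mem_lifts _).1 ((lifts_iff_coeff_lifts _).2 hlift)
  refine ⟨P, hP, fun h hm hi hne => ?_⟩
  obtain ⟨b, hb⟩ := φ.exists_tate_basis hf hs hs0 hm hi hne
  refine ⟨b, ?_⟩
  ext1 k
  apply AdicCompletion.ext_evalₐ
  intro n
  have h1 := congrArg (Polynomial.coeff · k) (TateModule.evalₐ_charpoly (LinearMap.toMatrix b b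
    (TateModule.map (φ.frobenius f))) n)
  simp only [coeff_map] at h1
  refine Eq.trans ?_ h1.symm
  rw [coeff_map]
  refine (AdicCompletion.evalₐ_of (Ideal.span {h}) n (P.coeff k)).trans ?_
  rw [Ideal.Quotient.mk_eq_mk_iff_sub_mem, Ideal.span_singleton_pow, Ideal.mem_span_singleton]
  have h2 := hb n k
  rw [← hP, coeff_map, coe_mapRingHom, ← Polynomial.map_sub, map_dvd_map'] at h2
  exact h2

end DrinfeldModule

/-! ### The conjugates of `θ` modulo `f` -/

section Conjugates

variable {Fq : Type*} [Field Fq] [Fintype Fq] (f : Fq[X]) [Fact (Irreducible f)]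

/-- The conjugate `θ ^ (q ^ i)` of the class of `θ` modulo `f`. -/
def conjTheta (i : ℕ) : ResidueClosure f := toResidueClosure f X ^ Fintype.card Fq ^ i

theorem conjTheta_pow (m l : ℕ) :
    conjTheta f m ^ Fintype.card Fq ^ l = conjTheta f (m + l) := by
  rw [conjTheta, conjTheta, ← pow_mul, ← pow_add]

theorem conjTheta_eq (i : ℕ) : conjTheta f i = algebraMap (AdjoinRoot f) (ResidueClosure f)
    ((FiniteField.frobeniusAlgHom Fq (AdjoinRoot f) ^ i) (AdjoinRoot.root f)) := by
  rw [AlgHom.coe_pow, FiniteField.coe_frobeniusAlgHom, pow_iterate, map_pow]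
  rfl

/-- An F_q-automorphism of A/f is determined by its value at θ, and Frobenius there has order d. -/
theorem conjTheta_injOn : Set.InjOn (conjTheta f) (Set.Iio f.natDegree) := by
  have hf : f ≠ 0 := (Fact.out : Irreducible f).ne_zero
  have : Module.Finite Fq (AdjoinRoot f) := (AdjoinRoot.powerBasis hf).finite
  have : Finite (AdjoinRoot f) := Module.finite_of_finite Fq
  have hord : orderOf (FiniteField.frobeniusAlgHom Fq (AdjoinRoot f)) = f.natDegree := by
    rw [FiniteField.orderOf_frobeniusAlgHom, (AdjoinRoot.powerBasis hf).finrank,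
      AdjoinRoot.powerBasis_dim]
  intro i hi j hj hij
  rw [conjTheta_eq, conjTheta_eq] at hij
  have h1 := AdjoinRoot.algHom_ext ((algebraMap (AdjoinRoot f) (ResidueClosure f)).injective hij)
  exact pow_injOn_Iio_orderOf (by rwa [hord]) (by rwa [hord]) h1

theorem conjTheta_add_natDegree (i : ℕ) : conjTheta f (f.natDegree + i) = conjTheta f i := by
  have := frobenius_pow_toResidueClosure f X
  rw [AlgHom.coe_pow, FiniteField.coe_frobeniusAlgHom, pow_iterate] at this
  rw [conjTheta, pow_add, pow_mul]
  exact congrArg (· ^ _) this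

theorem aeval_conjTheta (i : ℕ) (a : Fq[X]) :
    aeval (conjTheta f i) a = TorsionPairing.frobForm Fq _ i (toResidueClosure f a) := by
  change _ = (FiniteField.frobeniusAlgHom Fq (ResidueClosure f) ^ i) (toResidueClosure f a)
  rw [← aeval_toResidueClosure_X, ← aeval_algHom_apply]
  congr 2
  rw [AlgHom.coe_pow, FiniteField.coe_frobeniusAlgHom, pow_iterate]
  rfl

variable {f}

theorem map_eq_prod_conjTheta (hf : f.Monic) :
    f.map (algebraMap Fq (ResidueClosure f))
      = ∏ i ∈ Finset.range f.natDegree, (X - C (conjTheta f i)) := by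
  have hroot : ∀ i, (f.map (algebraMap Fq (ResidueClosure f))).IsRoot (conjTheta f i) := fun i => by
    rw [IsRoot.def, eval_map_algebraMap, aeval_conjTheta, (toResidueClosure_eq_zero_iff f f).2 dvd_rfl,
      map_zero]
  have hdvd : ∏ i ∈ Finset.range f.natDegree, (X - C (conjTheta f i))
      ∣ f.map (algebraMap Fq (ResidueClosure f)) := by
    refine Finset.prod_dvd_of_coprime (fun i hi j hj hij => ?_) fun i _ => dvd_iff_isRoot.2 (hroot i)
    refine (isCoprime_X_sub_C_of_isUnit_sub (IsUnit.mk0 _ (sub_ne_zero.2 fun h => hij ?_)))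
    exact conjTheta_injOn f (by simpa using hi) (by simpa using hj) h
  refine (eq_of_monic_of_dvd_of_natDegree_le (monic_prod_of_monic _ _ fun i _ => monic_X_sub_C _)
    (hf.map _) hdvd ?_)
  rw [natDegree_map, natDegree_prod_of_monic _ _ fun i _ => monic_X_sub_C _]
  simp

end Conjugates

/-! ### The value at zero -/

/-- At x = 0 every term that wraps around modulo d vanishes, which leaves an upper triangular
matrix. -/
theorem TwistedElimination.det_scalar_sub_thetaMatrix_zero {κ : Type*} [Field κ] (c : ℕ → ℕ → κ)
    (d s : ℕ) :
    (Matrix.scalar (Fin d) (X : κ[X]) - thetaMatrix (fun i j => C (c i j)) d s 0).det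
      = ∏ i ∈ Finset.range d, (X - C (c i 0)) := by
  have hentry : ∀ i k : Fin d, thetaMatrix (fun i j => (C (c i j) : κ[X])) d s 0 i k
      = ∑ j ∈ Finset.range (s + 1), if (i : ℕ) + j = k then C (c i j) else 0 := by
    intro i k
    rw [thetaMatrix, Matrix.of_apply]
    refine Finset.sum_congr rfl fun j _ => ?_
    rcases Nat.lt_or_ge ((i : ℕ) + j) d with h | h
    · simp [Nat.mod_eq_of_lt h, Nat.div_eq_of_lt h]
    · have h1 : ((i : ℕ) + j) / d ≠ 0 := (Nat.div_pos h i.pos).ne'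
      rw [zero_pow h1, mul_zero, ite_self, if_neg (by omega)]
  rw [Matrix.det_of_isUpperTriangular, ← Fin.prod_univ_eq_prod_range (fun i => X - C (c i 0))]
  · refine Finset.prod_congr rfl fun i _ => ?_
    rw [Matrix.sub_apply, hentry, Finset.sum_eq_single 0]
    · simp
    · intro j _ hj
      rw [if_neg (by omega)]
    · simp
  · intro i k hik
    have hik' : (k : ℕ) < i := hik
    rw [Matrix.sub_apply, hentry, Finset.sum_eq_zero]
    · simp [Matrix.diagonal_apply_ne _ (show i ≠ k from fun h => by simp [h] at hik')]
    · intro j _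
      rw [if_neg (by omega)]

namespace DrinfeldModule

variable {Fq : Type*} [Field Fq] [Fintype Fq] {r : ℕ} (φ : DrinfeldModule Fq r) {f : Fq[X]}
  [Fact (Irreducible f)] {s : ℕ}

/-- The coefficient `φ_{θ,j}(θ ^ (q ^ i))` of the reduction of `φ_θ`, conjugated by `τ ^ i`. -/
def conjCoeff (f : Fq[X]) [Fact (Irreducible f)] (i j : ℕ) : ResidueClosure f :=
  TorsionPairing.frobForm Fq _ i (φ.redCoeff f j)

theorem exists_det_eq_motiveCharpoly (hs : φ.IsReductionDegree f s) (hs0 : 0 < s) :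
    ∃ u : ResidueClosure f, u ≠ 0 ∧
      (Matrix.scalar (Fin f.natDegree) (C X : (ResidueClosure f)[X][X])
        - TwistedElimination.thetaMatrix (fun i j => C (C (φ.conjCoeff f i j))) f.natDegree s X).det
        = C (C u) * φ.motiveCharpoly f s := by
  refine TwistedElimination.exists_det_eq_charpoly (φ.conjCoeff f) f.natDegree s
    (Fact.out : Irreducible f).natDegree_pos hs0 fun i => ?_
  rw [conjCoeff, TorsionPairing.frobForm_apply]
  exact pow_ne_zero _ (φ.redCoeff_ne_zero hs)

/-- The image of `det (t - φ_θ)` under a ring homomorphism. -/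
theorem det_map_eq {S : Type*} [CommRing S] {u : ResidueClosure f}
    (hu : (Matrix.scalar (Fin f.natDegree) (C X : (ResidueClosure f)[X][X])
        - TwistedElimination.thetaMatrix (fun i j => C (C (φ.conjCoeff f i j))) f.natDegree s X).det
        = C (C u) * φ.motiveCharpoly f s) (g : (ResidueClosure f)[X][X] →+* S) :
    (Matrix.scalar (Fin f.natDegree) (g (C X)) - TwistedElimination.thetaMatrix
        (fun i j => g (C (C (φ.conjCoeff f i j)))) f.natDegree s (g X)).det
      = g (C (C u)) * g (φ.motiveCharpoly f s) := by
  rw [← map_mul, ← hu, RingHom.map_det, map_sub, RingHom.mapMatrix_apply, RingHom.mapMatrix_apply,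
    TwistedElimination.thetaMatrix_map]
  congr 2
  ext1 i j
  simp [Matrix.diagonal_apply, apply_ite g]

theorem map_eq_C_mul_coeff_zero (hf : f.Monic) {u : ResidueClosure f}
    (hu : (Matrix.scalar (Fin f.natDegree) (C X : (ResidueClosure f)[X][X])
        - TwistedElimination.thetaMatrix (fun i j => C (C (φ.conjCoeff f i j))) f.natDegree s X).det
        = C (C u) * φ.motiveCharpoly f s) :
    f.map (algebraMap Fq (ResidueClosure f)) = C u * (φ.motiveCharpoly f s).coeff 0 := by
  have h := φ.det_map_eq hu (evalRingHom 0)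
  simp only [coe_evalRingHom, eval_C, eval_X] at h
  rw [TwistedElimination.det_scalar_sub_thetaMatrix_zero] at h
  rw [coeff_zero_eq_eval_zero, ← h, map_eq_prod_conjTheta hf]
  refine Finset.prod_congr rfl fun i _ => ?_
  rw [conjCoeff, redCoeff_zero, ← aeval_conjTheta, aeval_X]

end DrinfeldModule

/-! ### The characteristic polynomial of the deformation -/

section Evaluation

variable {Fq K L : Type*} [Field Fq] [Fintype Fq] [Field K] [Algebra Fq K] [Field L] [Algebra K L]
  [Algebra Fq L] [IsScalarTower Fq K L] (f : Fq[X]) [Fact (Irreducible f)]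
  (ι : ResidueClosure f →ₐ[Fq] L)

/-- Evaluation at the `m`-th conjugate of `θ`. -/
def evalConj (K : Type*) [Field K] [Algebra Fq K] [Algebra K L] [IsScalarTower Fq K L] (m : ℕ) :
    AdjoinRoot (f.map (algebraMap Fq K)) →ₐ[K] L :=
  AdjoinRoot.liftAlgHom _ (Algebra.ofId K L) (ι (conjTheta f m)) (by
    change eval₂ (algebraMap K L) (ι (conjTheta f m)) (f.map (algebraMap Fq K)) = 0
    rw [eval₂_map, ← IsScalarTower.algebraMap_eq, ← aeval_def, aeval_algHom_apply, aeval_conjTheta,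
      (toResidueClosure_eq_zero_iff f f).2 dvd_rfl, map_zero, map_zero])

theorem evalConj_mk (m : ℕ) (g : K[X]) :
    evalConj f ι K m (AdjoinRoot.mk _ g) = aeval (ι (conjTheta f m)) g :=
  AdjoinRoot.liftAlgHom_mk ..

theorem evalConj_root (m : ℕ) : evalConj f ι K m (AdjoinRoot.root _) = ι (conjTheta f m) := by
  rw [← AdjoinRoot.mk_X, evalConj_mk, aeval_X]

theorem evalConj_tauQuot (m j : ℕ) (b : AdjoinRoot (f.map (algebraMap Fq K))) :
    evalConj f ι K m ((tauQuot K f ^ j) b) = evalConj f ι K (m + j) b := by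
  induction j generalizing b with
  | zero => rfl
  | succ j ih =>
    rw [pow_succ, AlgHom.mul_apply, ih]
    have : (evalConj f ι K (m + j)).comp (tauQuot K f) = evalConj f ι K (m + (j + 1)) := by
      apply AdjoinRoot.algHom_ext
      rw [AlgHom.comp_apply, tauQuot, AdjoinRoot.liftAlgHom_root, map_pow, evalConj_root,
        evalConj_root, ← map_pow]
      have := conjTheta_pow f (m + j) 1
      rw [pow_one] at this
      rw [this, add_assoc]
    exact DFunLike.congr_fun this b

theorem evalConj_add_natDegree (m : ℕ) : evalConj f ι K (f.natDegree + m) = evalConj f ι K m := by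
  apply AdjoinRoot.algHom_ext
  rw [evalConj_root, evalConj_root, conjTheta_add_natDegree]

variable {n : ℕ} (z : Fin n → K)

/-- The product `∏ₖ ∏_{l < m} (zₖ - θ ^ (q ^ l))`. -/
def weight (m : ℕ) : L :=
  ∏ k, ∏ l ∈ Finset.range m, (algebraMap K L (z k) - ι (conjTheta f l))

/-- This is the cocycle identity ℓ_(m+j) = ℓ_m · τ^m(ℓ_j), by which the weights absorb the
deformation factors. -/
theorem weight_mul_evalConj_ell (m j : ℕ) :
    weight f ι z m * evalConj f ι K m (AdjoinRoot.mk _ (∏ k, ell (Fintype.card Fq) j (z k)))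
      = weight f ι z (m + j) := by
  rw [evalConj_mk, map_prod, weight, weight, ← Finset.prod_mul_distrib]
  refine Finset.prod_congr rfl fun k _ => ?_
  rw [Finset.prod_range_add, ell, map_prod]
  congr 1
  refine Finset.prod_congr rfl fun l _ => ?_
  rw [map_sub, aeval_C, map_pow, aeval_X, ← map_pow, conjTheta_pow]

theorem evalConj_mk_map (m : ℕ) (a : Fq[X]) :
    evalConj f ι K m (AdjoinRoot.mk _ (a.map (algebraMap Fq K)))
      = ι (TorsionPairing.frobForm Fq _ m (toResidueClosure f a)) := by
  rw [evalConj_mk, aeval_map_algebraMap, aeval_algHom_apply, aeval_conjTheta]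

variable {f}

/-- The conjugates of θ are the roots of f, so ℓ_d(z) evaluates to f(z). -/
theorem weight_natDegree (hf : f.Monic) :
    weight f ι z f.natDegree = algebraMap K L (∏ k, aeval (z k) f) := by
  rw [map_prod]
  refine Finset.prod_congr rfl fun k _ => ?_
  have h := congrArg (eval₂ (ι : ResidueClosure f →+* L) (algebraMap K L (z k)))
    (map_eq_prod_conjTheta hf)
  rw [eval₂_map, eval₂_finsetProd] at h
  simp only [eval₂_sub, eval₂_X, eval₂_C] at h
  refine h.symm.trans ?_
  rw [AlgHom.comp_algebraMap, ← aeval_def, aeval_algebraMap_apply]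

theorem weight_add_natDegree (hf : f.Monic) (m : ℕ) :
    weight f ι z (f.natDegree + m)
      = algebraMap K L (∏ k, aeval (z k) f) * weight f ι z m := by
  rw [← weight_natDegree ι z hf, weight, weight, weight, ← Finset.prod_mul_distrib]
  refine Finset.prod_congr rfl fun k _ => ?_
  rw [Finset.prod_range_add]
  simp only [conjTheta_add_natDegree]

theorem weight_ne_zero (hf : f.Monic) (hz : ∀ k, aeval (z k) f ≠ 0) {m : ℕ}
    (hm : m ≤ f.natDegree) : weight f ι z m ≠ 0 := by
  have h : weight f ι z f.natDegree ≠ 0 := by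
    rw [weight_natDegree ι z hf, _root_.map_ne_zero]
    exact Finset.prod_ne_zero_iff.2 fun k _ => hz k
  rw [weight, Finset.prod_ne_zero_iff] at h ⊢
  intro k hk
  have h1 := h k hk
  rw [Finset.prod_ne_zero_iff] at h1 ⊢
  exact fun l hl => h1 l (Finset.mem_range.2 ((Finset.mem_range.1 hl).trans_le hm))

/-- The weighted evaluation at the `m`-th conjugate of `θ`. -/
def weightedEval (m : ℕ) (b : AdjoinRoot (f.map (algebraMap Fq K))) : L :=
  weight f ι z m * evalConj f ι K m b

theorem weightedEval_eq (hf : f.Monic) (m : ℕ) (b : AdjoinRoot (f.map (algebraMap Fq K))) :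
    weightedEval ι z m b = algebraMap K L (∏ k, aeval (z k) f) ^ (m / f.natDegree)
      * weightedEval ι z (m % f.natDegree) b := by
  have h : ∀ i m, weightedEval ι z (f.natDegree * i + m) b
      = algebraMap K L (∏ k, aeval (z k) f) ^ i * weightedEval ι z m b := by
    intro i m
    induction i with
    | zero => simp
    | succ i ih =>
      rw [mul_add, mul_one, add_comm (_ * i), add_assoc, weightedEval, weight_add_natDegree ι z hf,
        evalConj_add_natDegree, mul_assoc]
      rw [← weightedEval, ih, pow_succ', mul_assoc]
  rw [← h, Nat.div_add_mod]

/-- The matrix of the weighted evaluations. -/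
def weightedVandermonde : Matrix (Fin f.natDegree) (Fin f.natDegree) L :=
  Matrix.of fun i l => weightedEval (K := K) ι z i (AdjoinRoot.root _ ^ (l : ℕ))

/-- The matrix is a diagonal of weights times a Vandermonde matrix: the weights divide the nonzero ∏
f(z_k), and the conjugates are distinct. -/
theorem isUnit_det_weightedVandermonde (hf : f.Monic) (hz : ∀ k, aeval (z k) f ≠ 0) :
    IsUnit (weightedVandermonde ι z).det := by
  have h : weightedVandermonde ι z = Matrix.diagonal (fun i : Fin f.natDegree => weight f ι z i)
      * Matrix.vandermonde fun i => ι (conjTheta f i) := by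
    ext i l
    rw [Matrix.diagonal_mul, Matrix.vandermonde_apply]
    simp [weightedVandermonde, weightedEval, evalConj_root]
  rw [h, Matrix.det_mul, Matrix.det_diagonal, isUnit_iff_ne_zero]
  refine mul_ne_zero (Finset.prod_ne_zero_iff.2 fun i _ => weight_ne_zero ι z hf hz i.2.le) ?_
  rw [Matrix.det_vandermonde_ne_zero_iff]
  intro i j hij
  exact Fin.ext (conjTheta_injOn f i.2 j.2 (ι.toRingHom.injective hij))

end Evaluation

namespace DrinfeldModule

variable {Fq : Type*} [Field Fq] [Fintype Fq] {r : ℕ} (φ : DrinfeldModule Fq r)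

theorem deformation_X_coeff (n i : ℕ) :
    (φ.deformation n X).coeff i = if i ≤ r then (∏ k : Fin n, ell (Fintype.card Fq) i (zVar Fq k)) *
      (φ.coeff i).map (algebraMap Fq (RatFunField Fq n)) else 0 := by
  have hadd : ∀ (S : Finset ℕ) (P : ℕ → TwistedPoly (Fintype.card Fq) (RatFunField Fq n)),
      (∑ j ∈ S, P j).coeff i = ∑ j ∈ S, (P j).coeff i := fun S P =>
    map_sum (⟨⟨fun P => P.coeff i, rfl⟩, fun P Q => congrFun (congrArg DFunLike.coe
      (SkewMonoidAlgebra.coeff_add P Q)) (Multiplicative.ofAdd i)⟩ :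
      TwistedPoly (Fintype.card Fq) (RatFunField Fq n) →+ (RatFunField Fq n)[X]) P S
  have hmon : ∀ j a, (TwistedPoly.monomial (Fintype.card Fq) (K := RatFunField Fq n) j a).coeff i
      = if j = i then a else 0 := fun j a => SkewPolynomial.coeff_monomial
  rw [deformation, aeval_X, hadd]
  simp only [hmon]
  rw [Finset.sum_ite_eq']
  simp

theorem map_coeff_dvd {K : Type*} [Field K] [Algebra Fq K] {f : Fq[X]} {s : ℕ}
    (hs : φ.IsReductionDegree f s) {i : ℕ} (hi : s < i) :
    AdjoinRoot.mk (f.map (algebraMap Fq K)) ((φ.coeff i).map (algebraMap Fq K)) = 0 :=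
  AdjoinRoot.mk_eq_zero.2 (Polynomial.map_dvd _ (hs.2 i hi))

theorem le_rank {f : Fq[X]} {s : ℕ} (hs : φ.IsReductionDegree f s) : s ≤ r := by
  by_contra h
  refine hs.1 ?_
  rw [coeff, φ.coeff_eq_zero s (not_le.1 h)]
  exact dvd_zero f

variable {f : Fq[X]} {s : ℕ} (n : ℕ)

/-- The action of `θ` through `φ` on `𝔸 / f𝔸`. -/
abbrev quotAct (f : Fq[X]) : AdjoinRoot (f.map (algebraMap Fq (RatFunField Fq n))) →ₗ[RatFunField Fq n]
    AdjoinRoot (f.map (algebraMap Fq (RatFunField Fq n))) :=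
  (φ.deformation n X).act (AdjoinRoot.mkₐ (f.map (algebraMap Fq (RatFunField Fq n))))
    (tauQuot (RatFunField Fq n) f)

theorem quotAct_apply (hs : φ.IsReductionDegree f s)
    (b : AdjoinRoot (f.map (algebraMap Fq (RatFunField Fq n)))) :
    φ.quotAct n f b = ∑ j ∈ Finset.range (s + 1),
      AdjoinRoot.mk _ (∏ k : Fin n, ell (Fintype.card Fq) j (zVar Fq k)) *
        AdjoinRoot.mk _ ((φ.coeff j).map (algebraMap Fq (RatFunField Fq n))) *
          (tauQuot (RatFunField Fq n) f ^ j) b := by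
  rw [quotAct, TwistedPoly.act_apply_eq_sum _ _ _ s]
  · refine Finset.sum_congr rfl fun j hj => ?_
    have hj' : j ≤ r := (Nat.lt_succ_iff.1 (Finset.mem_range.1 hj)).trans (φ.le_rank hs)
    rw [deformation_X_coeff, if_pos hj', map_mul]
    rfl
  · intro i hi
    rw [deformation_X_coeff]
    split_ifs
    · rw [map_mul]
      exact mul_eq_zero_of_right _ (φ.map_coeff_dvd hs hi)
    · exact map_zero _

variable [Fact (Irreducible f)] {L : Type*} [Field L] [Algebra (RatFunField Fq n) L] [Algebra Fq L]
  [IsScalarTower Fq (RatFunField Fq n) L] (ι : ResidueClosure f →ₐ[Fq] L)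

theorem weightedEval_quotAct (hs : φ.IsReductionDegree f s) (m : ℕ)
    (b : AdjoinRoot (f.map (algebraMap Fq (RatFunField Fq n)))) :
    weightedEval ι (zVar Fq) m (φ.quotAct n f b) = ∑ j ∈ Finset.range (s + 1),
      ι (φ.conjCoeff f m j) * weightedEval ι (zVar Fq) (m + j) b := by
  rw [φ.quotAct_apply n hs, weightedEval, map_sum, Finset.mul_sum]
  refine Finset.sum_congr rfl fun j _ => ?_
  rw [map_mul, map_mul, evalConj_tauQuot, evalConj_mk_map, weightedEval,
    ← weight_mul_evalConj_ell f ι (zVar Fq) m j, conjCoeff, redCoeff]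
  ring

/-- The weighted evaluations behave under φ_θ like the powers of τ under right multiplication, and
index m + d reduces to m at the cost of ∏ f(z_k). This product therefore plays the role of x = τ^d.
-/
theorem thetaMatrix_mul_weightedVandermonde (hf : f.Monic) (hs : φ.IsReductionDegree f s)
    (pb : Module.Basis (Fin f.natDegree) (RatFunField Fq n)
      (AdjoinRoot (f.map (algebraMap Fq (RatFunField Fq n)))))
    (hpb : ∀ l, pb l = AdjoinRoot.root _ ^ (l : ℕ)) :
    TwistedElimination.thetaMatrix (fun i j => ι (φ.conjCoeff f i j)) f.natDegree s
        (algebraMap (RatFunField Fq n) L (∏ k, aeval (zVar Fq k) f)) *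
        weightedVandermonde (K := RatFunField Fq n) ι (zVar Fq)
      = weightedVandermonde (K := RatFunField Fq n) ι (zVar Fq) *
        (LinearMap.toMatrix pb pb (φ.quotAct n f)).map (algebraMap (RatFunField Fq n) L) := by
  have hd := (Fact.out : Irreducible f).natDegree_pos
  ext1 i l
  have h1 : (weightedVandermonde (K := RatFunField Fq n) ι (zVar Fq) *
        (LinearMap.toMatrix pb pb (φ.quotAct n f)).map (algebraMap (RatFunField Fq n) L)) i l
      = weightedEval ι (zVar Fq) i (φ.quotAct n f (pb l)) := by
    conv_rhs => rw [← pb.sum_repr (φ.quotAct n f (pb l))]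
    rw [Matrix.mul_apply, weightedEval, map_sum, Finset.mul_sum]
    refine Finset.sum_congr rfl fun j _ => ?_
    rw [Matrix.map_apply, LinearMap.toMatrix_apply, map_smul, Algebra.smul_def,
      weightedVandermonde, Matrix.of_apply, weightedEval, hpb j]
    ring
  rw [h1, φ.weightedEval_quotAct n ι hs, Matrix.mul_apply]
  simp only [TwistedElimination.thetaMatrix, Matrix.of_apply, Finset.sum_mul, ite_mul, zero_mul]
  rw [Finset.sum_comm]
  refine Finset.sum_congr rfl fun j _ => ?_
  rw [weightedEval_eq ι (zVar Fq) hf,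
    Finset.sum_eq_single ⟨((i : ℕ) + j) % f.natDegree, Nat.mod_lt _ hd⟩]
  · rw [if_pos rfl, weightedVandermonde, Matrix.of_apply, hpb, mul_assoc]
  · intro k _ hk
    rw [if_neg fun h => hk (Fin.ext h.symm)]
  · simp

theorem charpoly_quotAct_map [Module.Finite (RatFunField Fq n)
      (AdjoinRoot (f.map (algebraMap Fq (RatFunField Fq n))))] (hf : f.Monic) (hs : φ.IsReductionDegree f s)
    (hz : ∀ k : Fin n, aeval (zVar Fq k) f ≠ 0) :
    (φ.quotAct n f).charpoly.map (algebraMap (RatFunField Fq n) L)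
      = (TwistedElimination.thetaMatrix (fun i j => ι (φ.conjCoeff f i j)) f.natDegree s
        (algebraMap (RatFunField Fq n) L (∏ k, aeval (zVar Fq k) f))).charpoly := by
  have hfm := hf.map (algebraMap Fq (RatFunField Fq n))
  let e : Fin (AdjoinRoot.powerBasis' hfm).dim ≃ Fin f.natDegree := finCongr (by
    rw [AdjoinRoot.powerBasis'_dim, natDegree_map])
  let pb := (AdjoinRoot.powerBasis' hfm).basis.reindex e
  have hpb : ∀ l, pb l = AdjoinRoot.root _ ^ (l : ℕ) := fun l => by
    simp [pb, e]
  rw [← LinearMap.charpoly_toMatrix _ pb, ← Matrix.charpoly_map]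
  exact (Matrix.charpoly_eq_of_mul_eq_mul (isUnit_det_weightedVandermonde ι _ hf hz)
    (φ.thetaMatrix_mul_weightedVandermonde n ι hf hs pb hpb)).symm

end DrinfeldModule

theorem aeval_zVar_ne_zero {Fq : Type*} [Field Fq] {n : ℕ} (k : Fin n) {f : Fq[X]} (hf : f ≠ 0) :
    aeval (zVar Fq k) f ≠ 0 := by
  rw [zVar, aeval_algebraMap_apply, Ne, FaithfulSMul.algebraMap_eq_zero_iff]
  exact fun h => hf (transcendental_iff.1 (MvPolynomial.transcendental_X Fq k) f h)

theorem DrinfeldModule.charpoly_quotAct {Fq : Type*} [Field Fq] [Fintype Fq] {r : ℕ}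
    (φ : DrinfeldModule Fq r) {f : Fq[X]} [Fact (Irreducible f)] {s : ℕ} (n : ℕ)
    [Module.Finite (RatFunField Fq n) (AdjoinRoot (f.map (algebraMap Fq (RatFunField Fq n))))]
    (hf : f.Monic) (hs : φ.IsReductionDegree f s) {c : Fq}
    (hu : (Matrix.scalar (Fin f.natDegree) (C X : (ResidueClosure f)[X][X])
        - TwistedElimination.thetaMatrix (fun i j => C (C (φ.conjCoeff f i j))) f.natDegree s X).det
        = C (C (algebraMap Fq (ResidueClosure f) c)) * φ.motiveCharpoly f s) {P : Fq[X][X]}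
    (hP : P.map (mapRingHom (algebraMap Fq (ResidueClosure f))) = φ.motiveCharpoly f s) :
    (φ.quotAct n f).charpoly = ∑ i ∈ Finset.range (P.natDegree + 1),
      (C c * P.coeff i).map (algebraMap Fq (RatFunField Fq n)) *
        C ((∏ k : Fin n, aeval (zVar Fq k) f) ^ i) := by
  let K := RatFunField Fq n
  let L := AlgebraicClosure K
  have hfi : Irreducible f := Fact.out
  have : Module.Finite Fq (AdjoinRoot f) := (AdjoinRoot.powerBasis hfi.ne_zero).finite
  have : Algebra.IsAlgebraic Fq (ResidueClosure f) := Algebra.IsAlgebraic.trans Fq (AdjoinRoot f) _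
  -- The closure of A/f is algebraic over F_q, so it embeds in the algebraic closure of F_q(z₁, …,
  -- z_n), where conjugates of θ and the z_k coexist.
  let ι : ResidueClosure f →ₐ[Fq] L := IsAlgClosed.lift
  apply Polynomial.map_injective (algebraMap K L) (algebraMap K L).injective
  rw [φ.charpoly_quotAct_map n ι hf hs fun k => aeval_zVar_ne_zero k hfi.ne_zero]
  set S := ∏ k : Fin n, aeval (zVar Fq k) f
  -- Specialization of x to ∏ f(z_k), with t kept as the variable.
  have h := φ.det_map_eq hu (eval₂RingHom (mapRingHom (ι : ResidueClosure f →+* L))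
    (C (algebraMap K L S)))
  simp only [coe_eval₂RingHom, eval₂_C, eval₂_X, coe_mapRingHom, Polynomial.map_X,
    Polynomial.map_C, RingHom.coe_coe, AlgHom.commutes] at h
  have h1 : (Matrix.scalar (Fin f.natDegree) (X : L[X]) - TwistedElimination.thetaMatrix
      (fun i j => C (ι (φ.conjCoeff f i j))) f.natDegree s (C (algebraMap K L S))).det
      = (TwistedElimination.thetaMatrix (fun i j => ι (φ.conjCoeff f i j)) f.natDegree s
        (algebraMap K L S)).charpoly := by
    rw [Matrix.charpoly, Matrix.charmatrix, RingHom.mapMatrix_apply,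
      TwistedElimination.thetaMatrix_map]
  rw [← h1, h, ← hP, eval₂_map, eval₂_eq_sum_range, Polynomial.map_sum, Finset.mul_sum]
  refine Finset.sum_congr rfl fun i _ => ?_
  have h2 : ((mapRingHom (ι : ResidueClosure f →+* L)).comp
      (mapRingHom (algebraMap Fq (ResidueClosure f)))) = mapRingHom (algebraMap Fq L) := by
    rw [mapRingHom_comp, AlgHom.comp_algebraMap]
  rw [h2, Polynomial.map_mul, Polynomial.map_map, Polynomial.map_mul, Polynomial.map_C,
    Polynomial.map_C, ← IsScalarTower.algebraMap_eq, map_pow, C_pow, coe_mapRingHom, mul_assoc]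

theorem mainTheorem8 {Fq : Type*} [Field Fq] [Fintype Fq] (n r : ℕ) (φ : DrinfeldModule Fq r)
    (f : Fq[X]) (hf : f.Monic) [Fact (Irreducible f)]
    (r₀ : ℕ) (hr₀ : φ.IsReductionDegree f r₀) (hr₀_pos : 1 ≤ r₀) :
    ∃ (P : Fq[X][X]) (c : Fqˣ),
      (∀ h : Fq[X], h.Monic → Irreducible h → h ≠ f → φ.IsFrobeniusCharpoly f r₀ h P) ∧
      P.coeff 0 = C (↑c⁻¹ : Fq) * f ∧
      ∀ g : (RatFunField Fq n)[X],
        IsFittingGenerator (QuotModule (φ.deformation n) f) g ↔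
          g = f.map (algebraMap Fq (RatFunField Fq n)) +
            ∑ i ∈ Finset.Ico 1 r₀,
              (C (c : Fq) * P.coeff i).map (algebraMap Fq (RatFunField Fq n)) *
                C (∏ k : Fin n, (aeval (zVar Fq k) f) ^ i) +
            C (algebraMap Fq (RatFunField Fq n) c) *
              C (∏ k : Fin n, (aeval (zVar Fq k) f) ^ r₀) := by
  obtain ⟨P, hP, hchar⟩ := φ.exists_frobenius_charpoly hf hr₀ hr₀_pos
  obtain ⟨u, hu0, hu⟩ := φ.exists_det_eq_motiveCharpoly hr₀ hr₀_pos
  have hinj : Function.Injective (mapRingHom (algebraMap Fq (ResidueClosure f))) :=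
    Polynomial.map_injective _ (algebraMap Fq (ResidueClosure f)).injective
  have hPmonic : P.Monic := by
    apply hinj.monic_map_iff.2
    rw [hP]
    exact Matrix.charpoly_monic _
  have hPdeg : P.natDegree = r₀ := by
    rw [← natDegree_map_eq_of_injective hinj, hP, DrinfeldModule.motiveCharpoly,
      Matrix.charpoly_natDegree_eq_dim, Fintype.card_fin]
  have h0 := φ.map_eq_C_mul_coeff_zero hf hu
  rw [← hP, coeff_map, coe_mapRingHom] at h0
  -- the constant `c(f)` lies in `F_q`
  set v := (P.coeff 0).leadingCoeff
  have huv : u * algebraMap Fq (ResidueClosure f) v = 1 := by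
    have := congrArg leadingCoeff h0
    rw [leadingCoeff_mul, leadingCoeff_C, leadingCoeff_map, leadingCoeff_map, hf.leadingCoeff,
      map_one] at this
    exact this.symm
  have hv0 : v ≠ 0 := by
    rintro h
    rw [h, map_zero, mul_zero] at huv
    exact zero_ne_one huv
  have hP0 : P.coeff 0 = C v * f := by
    apply Polynomial.map_injective _ (algebraMap Fq (ResidueClosure f)).injective
    rw [Polynomial.map_mul, h0, Polynomial.map_C, ← mul_assoc, ← C_mul, mul_comm _ u, huv, C_1,
      one_mul]
  -- Since P.coeff 0 = v f, the constant c(f) is v⁻¹, whose image in κ is u.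
  let c : Fqˣ := (Units.mk0 v hv0)⁻¹
  have hcu : algebraMap Fq (ResidueClosure f) c = u := by
    have : (c : Fq) = v⁻¹ := rfl
    rw [this, map_inv₀]
    exact (eq_inv_of_mul_eq_one_left huv).symm
  refine ⟨P, c, hchar, ?_, fun g => ?_⟩
  · rw [hP0, inv_inv]
    rfl
  have hfin : Module.Finite (RatFunField Fq n)
      (AdjoinRoot (f.map (algebraMap Fq (RatFunField Fq n)))) :=
    (AdjoinRoot.powerBasis' (hf.map _)).finite
  rw [← hcu] at hu
  rw [isFittingGenerator_aeval'_iff, φ.charpoly_quotAct n hf hr₀ hu hP, hPdeg,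
    Finset.sum_range_succ, Finset.range_eq_Ico, Finset.sum_eq_sum_Ico_succ_bot hr₀_pos]
  have hterm : C (c : Fq) * P.coeff 0 = f := by
    rw [hP0, ← mul_assoc, ← C_mul]
    have : (c : Fq) * v = 1 := inv_mul_cancel₀ hv0
    rw [this, C_1, one_mul]
  have htop : P.coeff r₀ = 1 := by rw [← hPdeg]; exact hPmonic
  simp only [Finset.prod_pow, hterm, htop, pow_zero, C_1, mul_one, zero_add, Polynomial.map_C]
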